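/- Let $F, G \in \mathbb{R}[X,Y]$ and let $d, t$ be natural numbers with $t \ge 1$. Suppose that $F$ has total degree $d$ and is irreducible in $\mathbb{C}[X,Y]$, that $G$ is $t$-sparse (it has at most $t$ monomials), and that the system $F(X,Y) = G(X,Y) = 0$ has only finitely many real solutions. Let $N(F,G)$ be the number of its distinct solutions in $\mathbb{R}^2$. Then $N(F,G) = O(d^3 t + d^2 t^3)$: there is an absolute constant $C$ such that, for all such $d, t, F, G$, $$N(F,G) \le C\,(d^3 t + d^2 t^3).$$ More explicitly, there is a function $\varepsilon(d,t)$ of $d$ and $t$ only, with $\varepsilon(d,t) \to 0$ as $d + t \to \infty$, such that, for all such $d, t, F, G$, $$N(F,G) \le (2 d^3 t + 4 d^2 t^3)\,(1 + \varepsilon(d,t)).$$ -/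

import Mathlib

/-- A bivariate real polynomial is `t`-sparse if it has at most `t` monomials. -/
def IsSparse (t : ℕ) (G : MvPolynomial (Fin 2) ℝ) : Prop :=
  G.support.card ≤ t

/-- The set of real solutions `(x, y)` of the system `F(X,Y) = G(X,Y) = 0`. -/
def realSolutions (F G : MvPolynomial (Fin 2) ℝ) : Set (Fin 2 → ℝ) :=
  {p | MvPolynomial.eval p F = 0 ∧ MvPolynomial.eval p G = 0}

/-- The pair `(F, G)` is an admissible system with parameters `d` and `t`: `F` has total degree `d`
and is irreducible over `ℂ` (hence nonzero), `G` is `t`-sparse, and the system `F = G = 0` has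
finitely many real solutions. -/
structure IsAdmissibleSystem (d t : ℕ) (F G : MvPolynomial (Fin 2) ℝ) : Prop where
  totalDegree_eq : F.totalDegree = d
  irreducible : Irreducible (MvPolynomial.map (algebraMap ℝ ℂ) F)
  sparse : IsSparse t G
  finite : (realSolutions F G).Finite

/-! ### Bézout's inequality by counting dimensions -/

section Bezout

open MvPolynomial

/-! The proof runs Rolle's theorem along the real curve `F = 0`, using the derivation `D = XY(F_Y
∂_X - F_X ∂_Y)`. It is tangent to the curve and sends every monomial to a multiple of itself.

Modulo `F`, replace `G` by a combination `g` of `s ≤ t` monomials `f_0, …, f_{s-1}` that are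
independent modulo `F`, with nonzero coefficients. Let `W_k` be the Wronskian of `f_0, …, f_{k-1}`
and `U_k` that of `f_0, …, f_{k-1}, g`. Sylvester's determinant identity gives `D(U_k / W_{k+1}) =
W_k U_{k+1} / W_{k+1}²`. By Rolle, the zeros of `U_k` on the curve are therefore controlled by those
of `U_{k+1}`, `W_k` and `W_{k+1}` and by the number of arcs. Since `U_0 = g` and `U_{s-1}` is a
nonzero multiple of `W_s`, only zeros of Wronskians remain to be counted. Each `W_k` is a product of
monomials times a factor of degree at most `d k(k-1)/2`, whatever the exponents, so Bézout bounds
its zeros off the axes by `d²k²/2`. No `W_k` with `k ≤ s` vanishes on the curve: otherwise some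
quotient would be constant on an arc, and the monomials would be dependent modulo `F`.

The arcs come from a shear `x = u + cv` that makes the leading coefficient in `v` constant. At most
`B = d(d+1)` values of `u` are bad (a vertical tangent, a singular point or a point on an axis in
the fiber), and between them the curve consists of at most `d` continuous branches, hence at most
`(B+1)d` arcs. Adding at most `Bd` points in bad fibers gives `d³t + (7/2)d²t³`. If the curve is
itself a coordinate axis, the system is first moved to a parallel line. -/

theorem two_mul_finrank_restrictTotalDegree (m : ℕ) :
    2 * Module.finrank ℝ (restrictTotalDegree (Fin 2) ℝ m) = (m + 1) * (m + 2) := by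
  have hsum : ∀ n : Fin 2 →₀ ℕ, (n.sum fun _ e => e) = n 0 + n 1 := fun n => by
    rw [Finsupp.sum_fintype _ _ (fun _ => rfl), Fin.sum_univ_two]
  have e : {n : Fin 2 →₀ ℕ | (n.sum fun _ e => e) ≤ m} ≃
      ((Finset.range (m + 1)).sigma fun i => Finset.range (m + 1 - i) : Finset (Σ _ : ℕ, ℕ)) :=
    { toFun := fun n => ⟨⟨n.1 0, n.1 1⟩, by
        have := n.2
        simp only [Set.mem_ofPred_eq, hsum] at this
        simp only [Finset.mem_sigma, Finset.mem_range]; omega⟩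
      invFun := fun q => ⟨Finsupp.equivFunOnFinite.symm ![q.1.1, q.1.2], by
        have := q.2
        simp only [Finset.mem_sigma, Finset.mem_range] at this
        simp only [Set.mem_ofPred_eq, hsum]
        simp; omega⟩
      left_inv := fun n => by
        ext i; fin_cases i <;> simp
      right_inv := fun q => by
        ext <;> simp }
  have h1 : Module.finrank ℝ (restrictTotalDegree (Fin 2) ℝ m) =
      Nat.card {n : Fin 2 →₀ ℕ | (n.sum fun _ e => e) ≤ m} :=
    Module.finrank_eq_nat_card_basis (basisRestrictSupport ℝ _)
  rw [h1, Nat.card_congr e, Nat.card_eq_fintype_card, Fintype.card_coe, Finset.card_sigma]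
  simp only [Finset.card_range]
  have h2 : ∀ k : ℕ, 2 * ∑ i ∈ Finset.range (k + 1), (k + 1 - i) = (k + 1) * (k + 2) := by
    intro k
    rw [← Finset.sum_range_reflect]
    have : ∀ j ∈ Finset.range (k + 1), (k + 1 - (k + 1 - 1 - j)) = j + 1 := by
      intro j hj; rw [Finset.mem_range] at hj; omega
    rw [Finset.sum_congr rfl this, mul_comm, Finset.sum_add_distrib, add_mul,
      Finset.sum_range_id_mul_two]
    simp; ring
  exact h2 m

/-- Polynomials of sufficiently large degree separate finitely many points of the plane. -/
theorem exists_eval_eq_one_of_notMem {n : ℕ} (S : Finset (Fin 2 → ℝ)) (p : Fin 2 → ℝ)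
    (hp : p ∉ S) (hS : S.card ≤ n) :
    ∃ h : MvPolynomial (Fin 2) ℝ, h.totalDegree ≤ n ∧ eval p h = 1 ∧ ∀ q ∈ S, eval q h = 0 := by
  classical
  have hlin : ∀ q : Fin 2 → ℝ, q ≠ p → ∃ l : MvPolynomial (Fin 2) ℝ,
      l.totalDegree ≤ 1 ∧ eval p l = 1 ∧ eval q l = 0 := by
    intro q hq
    obtain ⟨i, hi⟩ := Function.ne_iff.mp hq
    refine ⟨C (p i - q i)⁻¹ * (X i - C (q i)), ?_, ?_, ?_⟩
    · refine (totalDegree_mul _ _).trans ?_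
      rw [totalDegree_C, zero_add]
      exact (totalDegree_sub_C_le _ _).trans (totalDegree_X i).le
    · simp [sub_ne_zero.mpr hi.symm]
    · simp
  choose! l hl using hlin
  have hne : ∀ q ∈ S, q ≠ p := fun q hq h => hp (h ▸ hq)
  refine ⟨∏ q ∈ S, l q, ?_, ?_, ?_⟩
  · refine (totalDegree_finsetProd _ _).trans ?_
    refine (Finset.sum_le_card_nsmul _ _ 1 fun q hq => (hl q (hne q hq)).1).trans ?_
    simpa using hS
  · rw [map_prod]
    exact Finset.prod_eq_one fun q hq => (hl q (hne q hq)).2.1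
  · intro q hq
    rw [map_prod]
    exact Finset.prod_eq_zero hq (hl q (hne q hq)).2.2

/-- Bézout's inequality for finite sets of common zeros. -/
theorem card_le_of_common_zeros {F P : MvPolynomial (Fin 2) ℝ} {d e : ℕ} (hF : Irreducible F)
    (hd : F.totalDegree = d) (hP : ¬ F ∣ P) (he : P.totalDegree ≤ e) (S : Finset (Fin 2 → ℝ))
    (hS : ∀ p ∈ S, eval p F = 0 ∧ eval p P = 0) : S.card ≤ d * e := by
  classical
  set n := S.card with hn
  let V : ℕ → Submodule ℝ (MvPolynomial (Fin 2) ℝ) := fun m => restrictTotalDegree (Fin 2) ℝ m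
  have hV : ∀ m (p : MvPolynomial (Fin 2) ℝ), p ∈ V m ↔ p.totalDegree ≤ m :=
    fun m p => mem_restrictTotalDegree _ _ _
  have hF0 : F ≠ 0 := hF.ne_zero
  -- The extra `n` in the degree makes evaluation at the `n` points surjective. It does not affect
  -- the final count.
  let ev : V (d + e + n) →ₗ[ℝ] (S → ℝ) :=
    LinearMap.pi fun p => (aeval (p : Fin 2 → ℝ)).toLinearMap ∘ₗ (V (d + e + n)).subtype
  have hev : ∀ h p, ev h p = eval (p : Fin 2 → ℝ) (h : MvPolynomial (Fin 2) ℝ) := fun h p => by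
    simp [ev, aeval_eq_eval]
  have hsurj : Function.Surjective ev := by
    rw [← LinearMap.range_eq_top, eq_top_iff, ← (Pi.basisFun ℝ S).span_eq, Submodule.span_le]
    rintro _ ⟨p, rfl⟩
    obtain ⟨h, h1, h2, h3⟩ := exists_eval_eq_one_of_notMem (n := d + e + n) (S.erase p) p
      (Finset.notMem_erase _ _) (((Finset.card_erase_le).trans hn.ge).trans (by omega))
    refine ⟨⟨h, (hV _ _).2 h1⟩, ?_⟩
    ext q
    rw [hev, Pi.basisFun_apply, Pi.single_apply]
    split_ifs with hq
    · simpa [hq] using h2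
    · exact h3 q (Finset.mem_erase.2 ⟨fun h => hq (Subtype.ext h), q.2⟩)
  let mu : (V (e + n) × V (d + n)) →ₗ[ℝ] V (d + e + n) :=
    LinearMap.codRestrict _
      (LinearMap.coprod ((LinearMap.mulLeft ℝ F) ∘ₗ (V (e + n)).subtype)
        ((LinearMap.mulLeft ℝ P) ∘ₗ (V (d + n)).subtype)) (by
      rintro ⟨a, b⟩
      refine Submodule.add_mem _ ((hV _ _).2 ?_) ((hV _ _).2 ?_)
      · refine (totalDegree_mul _ _).trans ?_
        have := (hV _ _).1 a.2
        simp only [LinearMap.fst_apply, Submodule.subtype_apply]; omega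
      · refine (totalDegree_mul _ _).trans ?_
        have := (hV _ _).1 b.2
        simp only [LinearMap.snd_apply, Submodule.subtype_apply]; omega)
  have hmu : ∀ a, (mu a : MvPolynomial (Fin 2) ℝ) = F * a.1 + P * a.2 := fun a => rfl
  -- The Koszul syzygies `(-Pc, Fc)`. They exhaust the kernel of `mu` because `F` is prime and does
  -- not divide `P`.
  let nu : V n →ₗ[ℝ] (V (e + n) × V (d + n)) :=
    LinearMap.prod
      (LinearMap.codRestrict _ (-(LinearMap.mulLeft ℝ P) ∘ₗ (V n).subtype) (by
        intro c
        refine (hV _ _).2 ?_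
        have := (hV _ _).1 c.2
        simp only [LinearMap.comp_apply, LinearMap.neg_apply, totalDegree_neg]
        refine (totalDegree_mul _ _).trans ?_
        simp only [Submodule.subtype_apply]; omega))
      (LinearMap.codRestrict _ ((LinearMap.mulLeft ℝ F) ∘ₗ (V n).subtype) (by
        intro c
        refine (hV _ _).2 ?_
        have := (hV _ _).1 c.2
        refine (totalDegree_mul _ _).trans ?_
        simp only [Submodule.subtype_apply]; omega))
  have hnu1 : ∀ c, ((nu c).1 : MvPolynomial (Fin 2) ℝ) = -(P * c) := fun c => rfl
  have hnu2 : ∀ c, ((nu c).2 : MvPolynomial (Fin 2) ℝ) = F * c := fun c => rfl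
  have hker : LinearMap.ker mu ≤ LinearMap.range nu := by
    rintro ⟨a, b⟩ hab
    have h0 : F * (a : MvPolynomial (Fin 2) ℝ) + P * b = 0 := by
      rw [← hmu ⟨a, b⟩, LinearMap.mem_ker.1 hab]; rfl
    have hdvd : F ∣ P * (b : MvPolynomial (Fin 2) ℝ) :=
      ⟨-a, by linear_combination h0⟩
    obtain ⟨c, hc⟩ := (hF.prime.dvd_or_dvd hdvd).resolve_left hP
    have hcdeg : c.totalDegree ≤ n := by
      by_cases hc0 : c = 0
      · simp [hc0]
      have := totalDegree_mul_of_isDomain hF0 hc0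
      rw [← hc, hd] at this
      have := (hV _ _).1 b.2
      omega
    refine ⟨⟨c, (hV _ _).2 hcdeg⟩, ?_⟩
    refine Prod.ext (Subtype.ext ?_) (Subtype.ext ?_)
    · rw [hnu1]
      refine mul_left_cancel₀ hF0 ?_
      rw [hc] at h0
      linear_combination -h0
    · rw [hnu2]; exact hc.symm
  have hle : LinearMap.range mu ≤ LinearMap.ker ev := by
    rintro _ ⟨a, rfl⟩
    ext p
    rw [hev, hmu, map_add, map_mul, map_mul, (hS p p.2).1, (hS p p.2).2]
    simp
  have d1 := LinearMap.finrank_range_add_finrank_ker ev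
  have d2 := LinearMap.finrank_range_add_finrank_ker mu
  have d3 := (Submodule.finrank_mono hker).trans (LinearMap.finrank_range_le nu)
  have d4 := Submodule.finrank_mono hle
  rw [LinearMap.range_eq_top.2 hsurj, finrank_top, Module.finrank_fintype_fun_eq_card,
    Fintype.card_coe] at d1
  rw [Module.finrank_prod] at d2
  have f1 := two_mul_finrank_restrictTotalDegree (d + e + n)
  have f2 := two_mul_finrank_restrictTotalDegree (e + n)
  have f3 := two_mul_finrank_restrictTotalDegree (d + n)
  have f4 := two_mul_finrank_restrictTotalDegree n
  simp only [V] at d1 d2 d3 d4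
  -- Since multiples of `F` and `P` vanish on `S`, `n ≤ dim V(d+e+n) - dim V(e+n) - dim V(d+n) + dim
  -- V(n)`, and this mixed second difference equals `de`.
  nlinarith

/-- An infinite set would contain a finite subset exceeding the Bézout bound. -/
theorem commonZeros_finite {F P : MvPolynomial (Fin 2) ℝ} (hF : Irreducible F) (hP : ¬ F ∣ P) :
    {p : Fin 2 → ℝ | eval p F = 0 ∧ eval p P = 0}.Finite := by
  by_contra h
  obtain ⟨S, hS, hc⟩ := Set.Infinite.exists_subset_card_eq h
    (F.totalDegree * P.totalDegree + 1)
  have := card_le_of_common_zeros hF rfl hP le_rfl S fun p hp => hS hp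
  omega

/-- Bézout's inequality for plane real algebraic curves. -/
theorem ncard_commonZeros_le {F P : MvPolynomial (Fin 2) ℝ} {d e : ℕ} (hF : Irreducible F)
    (hd : F.totalDegree = d) (hP : ¬ F ∣ P) (he : P.totalDegree ≤ e) :
    {p : Fin 2 → ℝ | eval p F = 0 ∧ eval p P = 0}.ncard ≤ d * e := by
  have hfin := commonZeros_finite hF hP
  rw [Set.ncard_eq_toFinset_card _ hfin]
  exact card_le_of_common_zeros hF hd hP he _ fun p hp => by simpa using hp

end Bezout

/-! ### Sylvester's identity and Wronskians -/

section Determinants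

open MvPolynomial

section Wronskian

/-- Sylvester's identity for two bordering rows and columns, by Schur complements. -/
theorem Matrix.det_mul_det_bordered_of_field {K : Type*} [Field K] (k : ℕ) (M : ℕ → ℕ → K)
    (σ : ℕ → ℕ) (hσ : ∀ i < k, σ i = i) (hσk : σ k = k + 1)
    (h0 : (Matrix.of fun i j : Fin k => M i j).det ≠ 0) :
    (Matrix.of fun i j : Fin k => M i j).det * (Matrix.of fun i j : Fin (k + 2) => M i j).det =
      (Matrix.of fun i j : Fin (k + 1) => M i j).det *
          (Matrix.of fun i j : Fin (k + 1) => M (σ i) (σ j)).det -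
        (Matrix.of fun i j : Fin (k + 1) => M i (σ j)).det *
          (Matrix.of fun i j : Fin (k + 1) => M (σ i) j).det := by
  set A : Matrix (Fin k) (Fin k) K := Matrix.of fun i j : Fin k => M i j with hA
  have : Invertible A := Matrix.invertibleOfIsUnitDet A (isUnit_iff_ne_zero.2 h0)
  -- Entries of the Schur complement of `A`. Each bordered determinant is `det A` times a minor of
  -- `S`, so the identity becomes the formula for a 2 × 2 determinant.
  let S : ℕ → ℕ → K := fun i j =>
    M i j - ∑ x : Fin k, (∑ y : Fin k, M i y * (⅟A) y x) * M x j
  have hbig : (Matrix.of fun i j : Fin (k + 2) => M i j).det =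
      A.det * (S k k * S (k + 1) (k + 1) - S k (k + 1) * S (k + 1) k) := by
    rw [← Matrix.det_submatrix_equiv_self (finSumFinEquiv (m := k) (n := 2)),
      ← Matrix.fromBlocks_toBlocks ((Matrix.of fun i j : Fin (k + 2) => M i j).submatrix _ _)]
    have : (Matrix.toBlocks₁₁ ((Matrix.of fun i j : Fin (k + 2) => M i j).submatrix
        (finSumFinEquiv (m := k) (n := 2)) (finSumFinEquiv (m := k) (n := 2)))) = A := by
      ext i j; simp [hA, Matrix.toBlocks₁₁]
    rw [this, Matrix.det_fromBlocks₁₁, Matrix.det_fin_two]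
    simp [S, Matrix.toBlocks₁₂, Matrix.toBlocks₂₁, Matrix.toBlocks₂₂, Matrix.mul_apply]
  have hsmall : ∀ r c : ℕ → ℕ, (∀ i < k, r i = i) → (∀ i < k, c i = i) →
      (Matrix.of fun i j : Fin (k + 1) => M (r i) (c j)).det = A.det * S (r k) (c k) := by
    intro r c hr hc
    rw [← Matrix.det_submatrix_equiv_self (finSumFinEquiv (m := k) (n := 1)),
      ← Matrix.fromBlocks_toBlocks
        ((Matrix.of fun i j : Fin (k + 1) => M (r i) (c j)).submatrix _ _)]
    have : (Matrix.toBlocks₁₁ ((Matrix.of fun i j : Fin (k + 1) => M (r i) (c j)).submatrix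
        (finSumFinEquiv (m := k) (n := 1)) (finSumFinEquiv (m := k) (n := 1)))) = A := by
      ext i j; simp [hA, Matrix.toBlocks₁₁, hr i i.2, hc j j.2]
    rw [this, Matrix.det_fromBlocks₁₁, Matrix.det_fin_one]
    simp [S, Matrix.toBlocks₁₂, Matrix.toBlocks₂₁, Matrix.toBlocks₂₂, Matrix.mul_apply, hr, hc]
  rw [hbig, hsmall σ σ hσ hσ, hsmall σ (fun j => j) hσ (fun _ _ => rfl),
    hsmall (fun j => j) σ (fun _ _ => rfl) hσ,
    hsmall (fun j => j) (fun j => j) (fun _ _ => rfl) (fun _ _ => rfl), hσk]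
  ring

theorem Matrix.det_mul_det_bordered {R : Type*} [CommRing R] [IsDomain R] (k : ℕ)
    (M : ℕ → ℕ → R) (σ : ℕ → ℕ) (hσ : ∀ i < k, σ i = i) (hσk : σ k = k + 1)
    (h0 : (Matrix.of fun i j : Fin k => M i j).det ≠ 0) :
    (Matrix.of fun i j : Fin k => M i j).det * (Matrix.of fun i j : Fin (k + 2) => M i j).det =
      (Matrix.of fun i j : Fin (k + 1) => M i j).det *
          (Matrix.of fun i j : Fin (k + 1) => M (σ i) (σ j)).det -
        (Matrix.of fun i j : Fin (k + 1) => M i (σ j)).det *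
          (Matrix.of fun i j : Fin (k + 1) => M (σ i) j).det := by
  have hinj := IsFractionRing.injective R (FractionRing R)
  have hdet : ∀ (n : ℕ) (r c : ℕ → ℕ),
      algebraMap R (FractionRing R) (Matrix.of fun i j : Fin n => M (r i) (c j)).det =
        (Matrix.of fun i j : Fin n => algebraMap R (FractionRing R) (M (r i) (c j))).det := by
    intro n r c
    rw [RingHom.map_det]; rfl
  have h0' := (map_ne_zero_iff _ hinj).2 h0
  have e1 := hdet k (fun i => i) (fun i => i)
  have e2 := hdet (k + 1) (fun i => i) (fun i => i)
  have e3 := hdet (k + 2) (fun i => i) (fun i => i)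
  have e4 := hdet (k + 1) σ (fun i => i)
  have e5 := hdet (k + 1) (fun i => i) σ
  have e6 := hdet (k + 1) σ σ
  rw [e1] at h0'
  apply hinj
  rw [map_mul, map_sub, map_mul, map_mul, e1, e2, e3, e4, e5, e6]
  exact Matrix.det_mul_det_bordered_of_field k (fun i j => algebraMap R (FractionRing R) (M i j))
    σ hσ hσk h0'

variable {k : Type*} {A : Type*} [CommRing k] [CommRing A] [Algebra k A] (D : Derivation k A A)

theorem Derivation.map_finset_prod {ι : Type*} [DecidableEq ι] (s : Finset ι) (f : ι → A) :
    D (∏ i ∈ s, f i) = ∑ i ∈ s, ∏ j ∈ s, Function.update f i (D (f i)) j := by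
  induction s using Finset.induction_on with
  | empty => simp
  | insert a s ha ih =>
    rw [Finset.prod_insert ha, D.leibniz, Finset.sum_insert ha, Finset.prod_insert ha, ih,
      Function.update_self, smul_eq_mul, smul_eq_mul, add_comm]
    congr 1
    · rw [mul_comm]
      congr 1
      refine Finset.prod_congr rfl fun j hj => ?_
      rw [Function.update_of_ne]
      rintro rfl
      exact ha hj
    · rw [Finset.mul_sum]
      refine Finset.sum_congr rfl fun i hi => ?_
      have hai : a ≠ i := fun h => ha (h ▸ hi)
      rw [Finset.prod_insert ha, Function.update_of_ne hai]

theorem Derivation.map_det {n : Type*} [Fintype n] [DecidableEq n] (M : Matrix n n A) :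
    D M.det = ∑ i, (M.updateRow i fun j => D (M i j)).det := by
  have h : ∀ N : Matrix n n A, N.det = ∑ σ : Equiv.Perm n, Equiv.Perm.sign σ • ∏ i, N i (σ i) :=
    fun N => by
      rw [← Matrix.det_transpose, Matrix.det_apply]; rfl
  simp_rw [h]
  rw [map_sum, Finset.sum_comm]
  refine Finset.sum_congr rfl fun σ _ => ?_
  rw [← Finset.smul_sum, Units.smul_def, Units.smul_def, map_zsmul, D.map_finset_prod]
  congr 1
  refine Finset.sum_congr rfl fun i _ => Finset.prod_congr rfl fun j _ => ?_
  by_cases hij : j = i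
  · subst hij; simp
  · simp [hij]

/-- The Wronskian of `f 0, …, f (n - 1)` with respect to a derivation. -/
def Derivation.wronskian (n : ℕ) (f : ℕ → A) : A :=
  (Matrix.of fun i j : Fin n => (⇑D)^[i] (f j)).det

@[simp]
theorem Derivation.wronskian_zero (f : ℕ → A) : D.wronskian 0 f = 1 := by
  simp [Derivation.wronskian]

theorem Derivation.wronskian_congr {n : ℕ} {f g : ℕ → A} (h : ∀ i < n, f i = g i) :
    D.wronskian n f = D.wronskian n g := by
  unfold Derivation.wronskian
  congr 1
  ext i j
  simp [h j j.2]

/-- Differentiating any row but the last repeats the next row, so a single term of Leibniz's rule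
survives. The map `σ` expresses the skipped derivative of order `n`. -/
theorem Derivation.map_wronskian_succ (n : ℕ) (f : ℕ → A) (σ : ℕ → ℕ) (hσ : ∀ i < n, σ i = i)
    (hσn : σ n = n + 1) : D (D.wronskian (n + 1) f) =
      (Matrix.of fun i j : Fin (n + 1) => (⇑D)^[σ i] (f j)).det := by
  unfold Derivation.wronskian
  rw [D.map_det, Finset.sum_eq_single (Fin.last n)]
  · congr 1
    ext i j
    by_cases hi : i = Fin.last n
    · subst hi
      simp [hσn, Function.iterate_succ_apply']
    · have : (i : ℕ) < n := Fin.val_lt_last hi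
      simp [hi, hσ i this]
  · intro i _ hi
    have hlt : (i : ℕ) < n := Fin.val_lt_last hi
    let i' : Fin (n + 1) := ⟨i + 1, by omega⟩
    have hne : i ≠ i' := fun h => by
      have := congrArg Fin.val h
      simp [i'] at this
    refine Matrix.det_zero_of_row_eq hne ?_
    ext j
    simp [hne.symm, i', Function.iterate_succ_apply']
  · simp

theorem Derivation.iterate_map_add' (i : ℕ) (x y : A) :
    (⇑D)^[i] (x + y) = (⇑D)^[i] x + (⇑D)^[i] y := by
  induction i with
  | zero => rfl
  | succ i ih => simp only [Function.iterate_succ_apply', ih, map_add]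

theorem Derivation.iterate_map_smul' (i : ℕ) (c : k) (x : A) :
    (⇑D)^[i] (c • x) = c • (⇑D)^[i] x := by
  induction i with
  | zero => rfl
  | succ i ih => simp only [Function.iterate_succ_apply', ih, map_smul]

theorem Derivation.wronskian_update (n : ℕ) (f : ℕ → A) (g : A) :
    D.wronskian (n + 1) (Function.update f n g) =
      ((Matrix.of fun i j : Fin (n + 1) => (⇑D)^[i] (f j)).updateCol (Fin.last n)
        fun i => (⇑D)^[i] g).det := by
  unfold Derivation.wronskian
  congr 1
  ext i j
  by_cases hj : j = Fin.last n
  · subst hj; simp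
  · have : (j : ℕ) ≠ n := (Fin.val_lt_last hj).ne
    simp [hj, this]

/-- The Wronskian of `f 0, …, f (n - 1), g` as a linear function of `g`. -/
def Derivation.wronskianSnoc (n : ℕ) (f : ℕ → A) : A →ₗ[k] A where
  toFun g := D.wronskian (n + 1) (Function.update f n g)
  map_add' x y := by
    simp_rw [D.wronskian_update, D.iterate_map_add']
    exact Matrix.det_updateCol_add _ _ _ _
  map_smul' c x := by
    simp_rw [D.wronskian_update, D.iterate_map_smul', Algebra.smul_def, RingHom.id_apply]
    exact Matrix.det_updateCol_smul _ _ _ _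

theorem Derivation.wronskianSnoc_apply (n : ℕ) (f : ℕ → A) (g : A) :
    D.wronskianSnoc n f g = D.wronskian (n + 1) (Function.update f n g) := rfl

theorem Derivation.wronskianSnoc_zero (f : ℕ → A) (g : A) : D.wronskianSnoc 0 f g = g := by
  simp [Derivation.wronskianSnoc_apply, Derivation.wronskian]

theorem Derivation.wronskianSnoc_self (n : ℕ) (f : ℕ → A) :
    D.wronskianSnoc n f (f n) = D.wronskian (n + 1) f := by
  rw [D.wronskianSnoc_apply, Function.update_eq_self]

theorem Derivation.wronskianSnoc_of_lt {n j : ℕ} (hj : j < n) (f : ℕ → A) :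
    D.wronskianSnoc n f (f j) = 0 := by
  rw [D.wronskianSnoc_apply]
  refine Matrix.det_zero_of_column_eq (i := ⟨j, by omega⟩) (j := Fin.last n)
    (fun h => hj.ne (congrArg Fin.val h)) fun i => ?_
  simp [hj.ne]

/-- The right side is the numerator of the derivative of `wronskianSnoc n f g / wronskian (n + 1)
f`. It is the determinant identity with `f n` and `g` as bordering columns and the derivatives of
orders `n` and `n + 1` as bordering rows. -/
theorem Derivation.wronskian_mul_wronskianSnoc_succ [IsDomain A] (n : ℕ) (f : ℕ → A) (g : A)
    (h0 : D.wronskian n f ≠ 0) :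
    D.wronskian n f * D.wronskianSnoc (n + 1) f g =
      D.wronskian (n + 1) f * D (D.wronskianSnoc n f g) -
        D.wronskianSnoc n f g * D (D.wronskian (n + 1) f) := by
  let σ : ℕ → ℕ := fun i => if i = n then n + 1 else i
  have hσ : ∀ i < n, σ i = i := fun i hi => if_neg hi.ne
  have hσn : σ n = n + 1 := if_pos rfl
  let F := Function.update f (n + 1) g
  have c1 : D.wronskian n f = D.wronskian n F :=
    D.wronskian_congr fun i hi => by simp [F, show i ≠ n + 1 by omega]
  have c2 : D.wronskian (n + 1) f = D.wronskian (n + 1) F :=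
    D.wronskian_congr fun i hi => by simp [F, show i ≠ n + 1 by omega]
  have c3 : D.wronskianSnoc n f g = D.wronskian (n + 1) (fun j => F (σ j)) :=
    D.wronskian_congr fun i hi => by
      rcases Nat.lt_succ_iff_lt_or_eq.1 hi with h | h
      · simp [F, hσ i h, h.ne, show i ≠ n + 1 by omega]
      · subst h; simp [F, hσn]
  have key := Matrix.det_mul_det_bordered n (fun i j => (⇑D)^[i] (F j)) σ hσ hσn
    (by rw [c1] at h0; exact h0)
  rw [c2, c3, D.map_wronskian_succ n _ σ hσ hσn, D.map_wronskian_succ n _ σ hσ hσn, c1]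
  exact key

theorem Derivation.wronskian_eq_prod_mul {n : ℕ} {f : ℕ → A} {q : ℕ → ℕ → A}
    (h : ∀ i < n, ∀ j < n, (⇑D)^[i] (f j) = f j * q i j) :
    D.wronskian n f = (∏ j : Fin n, f j) * (Matrix.of fun i j : Fin n => q i j).det := by
  rw [← Matrix.det_mul_row]
  unfold Derivation.wronskian
  congr 1
  ext i j
  simp [h i i.2 j j.2]

end Wronskian

theorem MvPolynomial.totalDegree_det_le {σ R : Type*} [CommRing R] {n : ℕ}
    (M : Matrix (Fin n) (Fin n) (MvPolynomial σ R)) (b : ℕ → ℕ)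
    (h : ∀ i j, (M i j).totalDegree ≤ b i) : M.det.totalDegree ≤ ∑ i ∈ Finset.range n, b i := by
  rw [← Matrix.det_transpose, Matrix.det_apply]
  refine totalDegree_finsetSum_le fun s _ => ?_
  rw [Units.smul_def, zsmul_eq_mul]
  refine (totalDegree_mul _ _).trans ?_
  have : ((((Equiv.Perm.sign s : ℤˣ) : ℤ) : MvPolynomial σ R)).totalDegree = 0 := by
    rw [← map_intCast (C : R →+* MvPolynomial σ R), totalDegree_C]
  rw [this, zero_add, ← Fin.sum_univ_eq_sum_range]
  exact (totalDegree_finsetProd _ _).trans (Finset.sum_le_sum fun i _ => h i (s i))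

end Determinants

/-! ### The tangent derivation and Wronskians of monomials -/

section Hamiltonian

open MvPolynomial

theorem MvPolynomial.totalDegree_pderiv_le {σ R : Type*} [CommSemiring R] (i : σ)
    (p : MvPolynomial σ R) : (pderiv i p).totalDegree ≤ p.totalDegree - 1 := by
  rw [totalDegree, Finset.sup_le_iff]
  intro m hm
  rw [mem_support_iff, coeff_pderiv] at hm
  have h : m + Finsupp.single i 1 ∈ p.support := by
    rw [mem_support_iff]; exact left_ne_zero_of_mul hm
  have := le_totalDegree h
  rw [Finsupp.sum_add_index' (fun _ => rfl) (fun _ _ _ => rfl), Finsupp.sum_single_index rfl] at this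
  omega

/-- The Hamiltonian derivation of `F`, tangent to the curve `F = 0`, multiplied by `X * Y`. -/
noncomputable def hamiltonian (F : MvPolynomial (Fin 2) ℝ) :
    Derivation ℝ (MvPolynomial (Fin 2) ℝ) (MvPolynomial (Fin 2) ℝ) :=
  (X 0 * X 1 * pderiv 1 F) • pderiv 0 - (X 0 * X 1 * pderiv 0 F) • pderiv 1

theorem hamiltonian_apply (F p : MvPolynomial (Fin 2) ℝ) :
    hamiltonian F p = X 0 * X 1 * (pderiv 1 F * pderiv 0 p - pderiv 0 F * pderiv 1 p) := by
  simp [hamiltonian]; ring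

/-- The two partial derivatives lower the degree by two, which compensates the factor `X * Y`. A
constant `p` is separated because its degree cannot drop. -/
theorem totalDegree_hamiltonian_le (F p : MvPolynomial (Fin 2) ℝ) (hF : 1 ≤ F.totalDegree) :
    (hamiltonian F p).totalDegree ≤ p.totalDegree + F.totalDegree := by
  by_cases hp : p.totalDegree = 0
  · rw [totalDegree_eq_zero_iff_eq_C] at hp
    rw [hp, hamiltonian_apply]
    simp
  rw [hamiltonian_apply]
  have h0 := totalDegree_pderiv_le 0 p
  have h1 := totalDegree_pderiv_le 1 p
  have k0 := totalDegree_pderiv_le 0 F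
  have k1 := totalDegree_pderiv_le 1 F
  have hX : (X 0 * X 1 : MvPolynomial (Fin 2) ℝ).totalDegree ≤ 2 :=
    (totalDegree_mul _ _).trans (by simp)
  refine (totalDegree_mul _ _).trans ?_
  have : (pderiv 1 F * pderiv 0 p - pderiv 0 F * pderiv 1 p).totalDegree ≤
      (F.totalDegree - 1) + (p.totalDegree - 1) := by
    refine (totalDegree_sub _ _).trans (max_le ?_ ?_)
    · exact (totalDegree_mul _ _).trans (by omega)
    · exact (totalDegree_mul _ _).trans (by omega)
  omega

/-- This is the purpose of the factor `X * Y`: exponents enter only as scalar coefficients of the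
cofactor, so they do not influence its degree bound. -/
theorem hamiltonian_monomial (F : MvPolynomial (Fin 2) ℝ) (e : Fin 2 →₀ ℕ) :
    hamiltonian F (monomial e 1) = monomial e 1 *
      ((e 0 : MvPolynomial (Fin 2) ℝ) * (X 1 * pderiv 1 F) -
        (e 1 : MvPolynomial (Fin 2) ℝ) * (X 0 * pderiv 0 F)) := by
  have h0 := X_mul_pderiv_monomial (i := (0 : Fin 2)) (m := e) (r := (1 : ℝ))
  have h1 := X_mul_pderiv_monomial (i := (1 : Fin 2)) (m := e) (r := (1 : ℝ))
  rw [nsmul_eq_mul] at h0 h1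
  rw [hamiltonian_apply]
  linear_combination X 1 * pderiv 1 F * h0 - X 0 * pderiv 0 F * h1

/-- The cofactor of the `i`-th Hamiltonian derivative of a monomial. -/
noncomputable def hamiltonianCofactor (F : MvPolynomial (Fin 2) ℝ) (e : Fin 2 →₀ ℕ) :
    ℕ → MvPolynomial (Fin 2) ℝ
  | 0 => 1
  | i + 1 => hamiltonian F (hamiltonianCofactor F e i) +
      ((e 0 : MvPolynomial (Fin 2) ℝ) * (X 1 * pderiv 1 F) -
        (e 1 : MvPolynomial (Fin 2) ℝ) * (X 0 * pderiv 0 F)) * hamiltonianCofactor F e i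

theorem iterate_hamiltonian_monomial (F : MvPolynomial (Fin 2) ℝ) (e : Fin 2 →₀ ℕ) (i : ℕ) :
    (⇑(hamiltonian F))^[i] (monomial e 1) = monomial e 1 * hamiltonianCofactor F e i := by
  induction i with
  | zero => simp [hamiltonianCofactor]
  | succ i ih =>
    rw [Function.iterate_succ_apply', ih, Derivation.leibniz, hamiltonian_monomial,
      hamiltonianCofactor, smul_eq_mul, smul_eq_mul]
    ring

theorem totalDegree_hamiltonianCofactor_le (F : MvPolynomial (Fin 2) ℝ) (e : Fin 2 →₀ ℕ)
    (hF : 1 ≤ F.totalDegree) (i : ℕ) :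
    (hamiltonianCofactor F e i).totalDegree ≤ i * F.totalDegree := by
  induction i with
  | zero => simp [hamiltonianCofactor]
  | succ i ih =>
    have hn : ∀ (n : ℕ) (p : MvPolynomial (Fin 2) ℝ),
        ((n : MvPolynomial (Fin 2) ℝ) * p).totalDegree ≤ p.totalDegree := fun n p => by
      refine (totalDegree_mul _ _).trans ?_
      rw [← map_natCast (C : ℝ →+* MvPolynomial (Fin 2) ℝ), totalDegree_C, zero_add]
    have hL : ∀ j : Fin 2, (X j * pderiv j F).totalDegree ≤ F.totalDegree := fun j => by
      refine (totalDegree_mul _ _).trans ?_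
      have := totalDegree_pderiv_le j F
      rw [totalDegree_X]
      omega
    rw [hamiltonianCofactor]
    refine (totalDegree_add _ _).trans (max_le ?_ ?_)
    · have := totalDegree_hamiltonian_le F (hamiltonianCofactor F e i) hF
      linarith
    · refine (totalDegree_mul _ _).trans ?_
      have : ((e 0 : MvPolynomial (Fin 2) ℝ) * (X 1 * pderiv 1 F) -
        (e 1 : MvPolynomial (Fin 2) ℝ) * (X 0 * pderiv 0 F)).totalDegree ≤ F.totalDegree :=
        (totalDegree_sub _ _).trans (max_le ((hn _ _).trans (hL _)) ((hn _ _).trans (hL _)))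
      linarith

/-- The Wronskian of monomials is a product of monomials and a factor of small degree. -/
theorem exists_wronskian_monomial_eq (F : MvPolynomial (Fin 2) ℝ) (hF : 1 ≤ F.totalDegree)
    (e : ℕ → Fin 2 →₀ ℕ) (n : ℕ) : ∃ q : MvPolynomial (Fin 2) ℝ,
      (hamiltonian F).wronskian n (fun j => monomial (e j) 1) =
        (∏ j : Fin n, monomial (e j) 1) * q ∧
      q.totalDegree ≤ (∑ i ∈ Finset.range n, i) * F.totalDegree := by
  refine ⟨_, Derivation.wronskian_eq_prod_mul (q := fun i j => hamiltonianCofactor F (e j) i) _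
    fun i _ j _ => iterate_hamiltonian_monomial F (e j) i, ?_⟩
  rw [Finset.sum_mul]
  exact totalDegree_det_le _ _ fun i j => totalDegree_hamiltonianCofactor_le F (e j) hF i

end Hamiltonian

open Filter Topology

/-! ### Continuity of the ordered real roots of a family of functions -/

section Branches

/-- The number of elements of `s` below `v`. -/
noncomputable def Finset.rankBelow (s : Finset ℝ) (v : ℝ) : ℕ := (s.filter (· < v)).card

theorem Finset.rankBelow_lt_of_lt {s : Finset ℝ} {v w : ℝ} (hv : v ∈ s) (h : v < w) :
    s.rankBelow v < s.rankBelow w := by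
  refine Finset.card_lt_card (Finset.ssubset_iff_of_subset ?_ |>.2 ⟨v, ?_, ?_⟩)
  · intro x hx
    rw [Finset.mem_filter] at hx ⊢
    exact ⟨hx.1, hx.2.trans h⟩
  · exact Finset.mem_filter.2 ⟨hv, h⟩
  · simp

theorem Finset.rankBelow_injOn (s : Finset ℝ) : Set.InjOn s.rankBelow s := by
  intro v hv w hw h
  rcases lt_trichotomy v w with h1 | h1 | h1
  · exact absurd h (Finset.rankBelow_lt_of_lt hv h1).ne
  · exact h1
  · exact absurd h (Finset.rankBelow_lt_of_lt hw h1).ne'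

theorem Finset.rankBelow_lt_card {s : Finset ℝ} {v : ℝ} (hv : v ∈ s) :
    s.rankBelow v < s.card :=
  Finset.card_lt_card (Finset.filter_ssubset.2 ⟨v, hv, lt_irrefl v⟩)

theorem Finset.exists_rankBelow_eq {s : Finset ℝ} {i : ℕ} (hi : i < s.card) :
    ∃ v ∈ s, s.rankBelow v = i := by
  have himg : s.image s.rankBelow = Finset.range s.card := by
    refine Finset.eq_of_subset_of_card_le ?_ ?_
    · intro j hj
      obtain ⟨v, hv, rfl⟩ := Finset.mem_image.1 hj
      exact Finset.mem_range.2 (Finset.rankBelow_lt_card hv)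
    · rw [Finset.card_image_of_injOn s.rankBelow_injOn, Finset.card_range]
  have := Finset.mem_range.2 hi
  rw [← himg] at this
  simpa using this

/-- Order-preserving transport of roots keeps their ranks, so the `i`-th root goes to the `i`-th
root. -/
theorem Finset.rankBelow_image {s : Finset ℝ} {e : ℝ → ℝ} (he : StrictMonoOn e s) {v : ℝ}
    (hv : v ∈ s) : (s.image e).rankBelow (e v) = s.rankBelow v := by
  have : (s.image e).filter (· < e v) = (s.filter (· < v)).image e := by
    ext x
    simp only [Finset.mem_filter, Finset.mem_image]
    constructor
    · rintro ⟨⟨w, hw, rfl⟩, h⟩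
      exact ⟨w, ⟨hw, (he.lt_iff_lt hw hv).1 h⟩, rfl⟩
    · rintro ⟨w, ⟨hw, h⟩, rfl⟩
      exact ⟨⟨w, hw, rfl⟩, he hw hv h⟩
  rw [Finset.rankBelow, this, Finset.card_image_of_injOn]
  · rfl
  · exact he.injOn.mono (Finset.coe_subset.2 (Finset.filter_subset _ _))

/-- The element of `s` with exactly `i` elements of `s` below it. -/
noncomputable def Finset.nthElement (s : Finset ℝ) (i : ℕ) : ℝ :=
  if h : i < s.card then (Finset.exists_rankBelow_eq h).choose else 0

theorem Finset.nthElement_mem {s : Finset ℝ} {i : ℕ} (hi : i < s.card) : s.nthElement i ∈ s := by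
  rw [Finset.nthElement, dif_pos hi]
  exact (Finset.exists_rankBelow_eq hi).choose_spec.1

theorem Finset.rankBelow_nthElement {s : Finset ℝ} {i : ℕ} (hi : i < s.card) :
    s.rankBelow (s.nthElement i) = i := by
  rw [Finset.nthElement, dif_pos hi]
  exact (Finset.exists_rankBelow_eq hi).choose_spec.2

theorem Finset.nthElement_rankBelow {s : Finset ℝ} {v : ℝ} (hv : v ∈ s) :
    s.nthElement (s.rankBelow v) = v :=
  s.rankBelow_injOn (Finset.nthElement_mem (Finset.rankBelow_lt_card hv)) hv
    (Finset.rankBelow_nthElement (Finset.rankBelow_lt_card hv))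

variable {f fv : ℝ → ℝ → ℝ} {R : ℝ → Finset ℝ}

theorem injOn_of_deriv_ne_zero {g g' : ℝ → ℝ} {a b : ℝ} (hg : ∀ x, HasDerivAt g (g' x) x)
    (h : ∀ x ∈ Set.Icc a b, g' x ≠ 0) : Set.InjOn g (Set.Icc a b) := by
  have key : ∀ x ∈ Set.Icc a b, ∀ y ∈ Set.Icc a b, x < y → g x ≠ g y := by
    intro x hx y hy hxy he
    obtain ⟨z, hz, hz'⟩ := exists_hasDerivAt_eq_zero hxy
      (fun t _ => (hg t).continuousAt.continuousWithinAt) he (fun t _ => hg t)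
    exact h z ⟨hx.1.trans hz.1.le, hz.2.le.trans hy.2⟩ hz'
  intro x hx y hy he
  rcases lt_trichotomy x y with h1 | h1 | h1
  · exact absurd he (key x hx y hy h1)
  · exact h1
  · exact absurd he.symm (key y hy x hx h1)

/-- A nonvanishing derivative makes `g` injective, hence strictly monotone, near its zero. -/
theorem mul_neg_of_simple_zero {g g' : ℝ → ℝ} {v δ : ℝ} (hδ : 0 < δ)
    (hg : ∀ x, HasDerivAt g (g' x) x) (h : ∀ x ∈ Set.Icc (v - δ) (v + δ), g' x ≠ 0)
    (h0 : g v = 0) : g (v - δ) * g (v + δ) < 0 := by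
  have hinj := injOn_of_deriv_ne_zero hg h
  have hcont : ContinuousOn g (Set.Icc (v - δ) (v + δ)) :=
    fun t _ => (hg t).continuousAt.continuousWithinAt
  have m1 : v - δ ∈ Set.Icc (v - δ) (v + δ) := ⟨le_rfl, by linarith⟩
  have m2 : v ∈ Set.Icc (v - δ) (v + δ) := ⟨by linarith, by linarith⟩
  have m3 : v + δ ∈ Set.Icc (v - δ) (v + δ) := ⟨by linarith, le_rfl⟩
  rcases hcont.strictMonoOn_of_injOn_Icc' (by linarith) hinj with hm | hm
  · have a1 := hm m1 m2 (by linarith)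
    have a2 := hm m2 m3 (by linarith)
    rw [h0] at a1 a2
    exact mul_neg_of_neg_of_pos a1 a2
  · have a1 := hm m1 m2 (by linarith)
    have a2 := hm m2 m3 (by linarith)
    rw [h0] at a1 a2
    exact mul_neg_of_pos_of_neg a1 a2

/-- Near a parameter all of whose zeros are simple, the zeros move continuously. -/
theorem eventually_exists_root_transport (hf : Continuous fun p : ℝ × ℝ => f p.1 p.2)
    (hfv : Continuous fun p : ℝ × ℝ => fv p.1 p.2)
    (hder : ∀ u v, HasDerivAt (f u) (fv u v) v) (hR : ∀ u v, v ∈ R u ↔ f u v = 0) (u₀ : ℝ)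
    (hbdd : ∃ M, ∀ᶠ u in 𝓝 u₀, ∀ v, f u v = 0 → |v| ≤ M)
    (hsimple : ∀ v ∈ R u₀, fv u₀ v ≠ 0) (ε : ℝ) (hε : 0 < ε) :
    ∀ᶠ u in 𝓝 u₀, ∃ e : ℝ → ℝ, StrictMonoOn e (R u₀) ∧ (R u₀).image e = R u ∧
      ∀ v ∈ R u₀, |e v - v| < ε := by
  -- A radius `δ` is sought for which the intervals around the roots are disjoint and carry a
  -- nonzero derivative for all nearby `u`. The sign change then gives a root in each interval, and
  -- injectivity makes it unique.
  have E1 : ∀ v₀ ∈ R u₀, ∀ᶠ δ in 𝓝[>] (0 : ℝ), ∀ᶠ u in 𝓝 u₀,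
      ∀ v ∈ Set.Icc (v₀ - δ) (v₀ + δ), fv u v ≠ 0 := by
    intro v₀ hv₀
    have : ∀ᶠ p in 𝓝 (u₀, v₀), fv p.1 p.2 ≠ 0 := hfv.continuousAt.eventually_ne (hsimple v₀ hv₀)
    rw [nhds_prod_eq] at this
    obtain ⟨pa, hpa, pb, hpb, hab⟩ := eventually_prod_iff.1 this
    obtain ⟨r, hr, hrb⟩ := Metric.eventually_nhds_iff.1 hpb
    filter_upwards [Ioo_mem_nhdsGT hr] with δ hδ
    filter_upwards [hpa] with u hu v hv
    refine hab hu (hrb ?_)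
    rw [Real.dist_eq, abs_lt]
    constructor <;> linarith [hv.1, hv.2, hδ.2]
  have E2 : ∀ v₀ ∈ R u₀, ∀ v₁ ∈ R u₀, ∀ᶠ δ in 𝓝[>] (0 : ℝ), v₀ < v₁ → v₀ + δ < v₁ - δ := by
    intro v₀ _ v₁ _
    by_cases h : v₀ < v₁
    · filter_upwards [Ioo_mem_nhdsGT (show (0 : ℝ) < (v₁ - v₀) / 2 by linarith)] with δ hδ _
      linarith [hδ.2]
    · exact Eventually.of_forall fun _ h' => absurd h' h
  have E3 : ∀ᶠ δ in 𝓝[>] (0 : ℝ), 0 < δ ∧ δ < ε := Ioo_mem_nhdsGT hε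
  obtain ⟨δ, h1, h2, hδ, hδε⟩ := ((((R u₀).eventually_all).2 E1).and
    (((((R u₀).eventually_all).2 fun v₀ hv₀ => ((R u₀).eventually_all).2 (E2 v₀ hv₀))).and
      E3)).exists
  have E4 : ∀ v₀ ∈ R u₀, ∀ᶠ u in 𝓝 u₀, f u (v₀ - δ) * f u (v₀ + δ) < 0 := by
    intro v₀ hv₀
    have hneg : f u₀ (v₀ - δ) * f u₀ (v₀ + δ) < 0 :=
      mul_neg_of_simple_zero hδ (hder u₀) (h1 v₀ hv₀).self_of_nhds ((hR _ _).1 hv₀)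
    have hc : Continuous fun u => f u (v₀ - δ) * f u (v₀ + δ) :=
      (hf.comp (Continuous.prodMk_left _)).mul (hf.comp (Continuous.prodMk_left _))
    exact hc.continuousAt.eventually_lt continuousAt_const hneg
  obtain ⟨M, hM⟩ := hbdd
  have E5 : ∀ᶠ u in 𝓝 u₀, ∀ v, f u v = 0 → ∃ v₀ ∈ R u₀, |v - v₀| < δ := by
    -- No root appears away from the old ones: `f u₀` has no zero on this compact set, hence neither
    -- has `f u` for `u` near `u₀`, and `M` prevents roots from arriving from infinity.
    let K : Set ℝ := Set.Icc (-M) M ∩ ⋂ v₀ ∈ R u₀, {v | δ ≤ |v - v₀|}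
    have hK : IsCompact K := by
      refine isCompact_Icc.inter_right ?_
      refine isClosed_biInter fun v₀ _ => ?_
      exact isClosed_le continuous_const (by fun_prop)
    have hev : ∀ᶠ u in 𝓝 u₀, ∀ v ∈ K, f u v ≠ 0 := by
      refine hK.eventually_forall_of_forall_eventually fun v hv => ?_
      refine hf.continuousAt.eventually_ne (x := (u₀, v)) ?_
      intro h0
      have := Set.mem_iInter₂.1 hv.2 v ((hR _ _).2 h0)
      simp only [Set.mem_ofPred_eq, sub_self, abs_zero] at this
      linarith
    filter_upwards [hev, hM] with u hu hMu v hv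
    by_contra! hcon
    exact hu v ⟨abs_le.1 (hMu v hv), Set.mem_iInter₂.2 hcon⟩ hv
  filter_upwards [((R u₀).eventually_all).2 h1, ((R u₀).eventually_all).2 E4, E5] with u a1 a4 a5
  have hroot : ∀ v₀ ∈ R u₀, ∃ w ∈ Set.Ioo (v₀ - δ) (v₀ + δ), f u w = 0 := by
    intro v₀ hv₀
    have hc : ContinuousOn (f u) (Set.Icc (v₀ - δ) (v₀ + δ)) :=
      fun t _ => (hder u t).continuousAt.continuousWithinAt
    rcases mul_neg_iff.1 (a4 v₀ hv₀) with ⟨p, q⟩ | ⟨p, q⟩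
    · exact intermediate_value_Ioo' (by linarith) hc ⟨q, p⟩
    · exact intermediate_value_Ioo (by linarith) hc ⟨p, q⟩
  choose! e he using hroot
  refine ⟨e, ?_, ?_, ?_⟩
  · intro v hv w hw hvw
    have := h2 v hv w hw hvw
    linarith [(he v hv).1.2, (he w hw).1.1]
  · ext w
    rw [Finset.mem_image, hR]
    constructor
    · rintro ⟨v, hv, rfl⟩
      exact (he v hv).2
    · intro hw
      obtain ⟨v, hv, hvw⟩ := a5 w hw
      rw [abs_lt] at hvw
      refine ⟨v, hv, injOn_of_deriv_ne_zero (hder u) (a1 v hv)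
        (Set.Ioo_subset_Icc_self (he v hv).1) ⟨by linarith, by linarith⟩ ?_⟩
      rw [(he v hv).2, hw]
  · intro v hv
    rw [abs_lt]
    constructor <;> linarith [(he v hv).1.1, (he v hv).1.2]

theorem eventually_card_eq_of_simple (hf : Continuous fun p : ℝ × ℝ => f p.1 p.2)
    (hfv : Continuous fun p : ℝ × ℝ => fv p.1 p.2)
    (hder : ∀ u v, HasDerivAt (f u) (fv u v) v) (hR : ∀ u v, v ∈ R u ↔ f u v = 0) (u₀ : ℝ)
    (hbdd : ∃ M, ∀ᶠ u in 𝓝 u₀, ∀ v, f u v = 0 → |v| ≤ M)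
    (hsimple : ∀ v ∈ R u₀, fv u₀ v ≠ 0) : ∀ᶠ u in 𝓝 u₀, (R u).card = (R u₀).card := by
  filter_upwards [eventually_exists_root_transport hf hfv hder hR u₀ hbdd hsimple 1 one_pos]
    with u ⟨e, he, himg, _⟩
  rw [← himg, Finset.card_image_of_injOn he.injOn]

theorem continuousAt_nthElement_of_simple (hf : Continuous fun p : ℝ × ℝ => f p.1 p.2)
    (hfv : Continuous fun p : ℝ × ℝ => fv p.1 p.2)
    (hder : ∀ u v, HasDerivAt (f u) (fv u v) v) (hR : ∀ u v, v ∈ R u ↔ f u v = 0) (u₀ : ℝ)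
    (hbdd : ∃ M, ∀ᶠ u in 𝓝 u₀, ∀ v, f u v = 0 → |v| ≤ M)
    (hsimple : ∀ v ∈ R u₀, fv u₀ v ≠ 0) {i : ℕ} (hi : i < (R u₀).card) :
    ContinuousAt (fun u => (R u).nthElement i) u₀ := by
  rw [Metric.continuousAt_iff']
  intro ε hε
  filter_upwards [eventually_exists_root_transport hf hfv hder hR u₀ hbdd hsimple ε hε]
    with u ⟨e, he, himg, hclose⟩
  have hmem := Finset.nthElement_mem hi
  have hr := Finset.rankBelow_image he hmem
  rw [Finset.rankBelow_nthElement hi, himg] at hr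
  have hin : e ((R u₀).nthElement i) ∈ R u := by
    rw [← himg]; exact Finset.mem_image_of_mem _ hmem
  have := Finset.nthElement_rankBelow hin
  rw [hr] at this
  rw [this, Real.dist_eq]
  exact hclose _ hmem

/-- The number of roots is locally constant, and an interval is connected. -/
theorem card_eq_of_simple_on_Icc (hf : Continuous fun p : ℝ × ℝ => f p.1 p.2)
    (hfv : Continuous fun p : ℝ × ℝ => fv p.1 p.2)
    (hder : ∀ u v, HasDerivAt (f u) (fv u v) v) (hR : ∀ u v, v ∈ R u ↔ f u v = 0)
    (hbdd : ∀ u₀, ∃ M, ∀ᶠ u in 𝓝 u₀, ∀ v, f u v = 0 → |v| ≤ M) {a b : ℝ}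
    (hsimple : ∀ u ∈ Set.Icc a b, ∀ v ∈ R u, fv u v ≠ 0) {x y : ℝ} (hx : x ∈ Set.Icc a b)
    (hy : y ∈ Set.Icc a b) : (R x).card = (R y).card := by
  refine isPreconnected_Icc.constant (f := fun u => (R u).card) (fun u hu => ?_) hx hy
  refine ContinuousAt.continuousWithinAt ?_
  have := eventually_card_eq_of_simple hf hfv hder hR u (hbdd u) (hsimple u hu)
  exact (continuousAt_const (y := (R u).card)).congr (this.mono fun _ h => h.symm)

end Branches

/-! ### Sheared coordinates and restriction to the fibers -/

section Shear

theorem MvPolynomial.hasDerivAt_eval_comp {γ : ℝ → Fin 2 → ℝ} {γ' : Fin 2 → ℝ} {t : ℝ}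
    (hγ : ∀ i, HasDerivAt (fun s => γ s i) (γ' i) t) (p : MvPolynomial (Fin 2) ℝ) :
    HasDerivAt (fun s => eval (γ s) p)
      (eval (γ t) (pderiv 0 p) * γ' 0 + eval (γ t) (pderiv 1 p) * γ' 1) t := by
  induction p using MvPolynomial.induction_on with
  | C a => simpa using hasDerivAt_const t a
  | add p q hp hq =>
    simp only [map_add]
    exact (hp.add hq).congr_deriv (by ring)
  | mul_X p i hp =>
    simp only [map_mul, eval_X, Derivation.leibniz, smul_eq_mul, map_add]
    refine (hp.mul (hγ i)).congr_deriv ?_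
    fin_cases i <;> simp <;> ring

/-- Hadamard's lemma for bivariate polynomials. -/
theorem MvPolynomial.exists_sub_eval_eq (p : MvPolynomial (Fin 2) ℝ) (x : Fin 2 → ℝ) :
    ∃ a : Fin 2 → MvPolynomial (Fin 2) ℝ, (∀ i, eval x (a i) = eval x (pderiv i p)) ∧
      p - C (eval x p) = (X 0 - C (x 0)) * a 0 + (X 1 - C (x 1)) * a 1 := by
  induction p using MvPolynomial.induction_on with
  | C r => exact ⟨0, by simp, by simp⟩
  | add p q hp hq =>
    obtain ⟨a, ha, ha'⟩ := hp
    obtain ⟨b, hb, hb'⟩ := hq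
    refine ⟨a + b, fun i => by simp [ha, hb], ?_⟩
    simp only [map_add, Pi.add_apply]
    linear_combination ha' + hb'
  | mul_X p i hp =>
    obtain ⟨a, ha, ha'⟩ := hp
    refine ⟨fun j => a j * X i + C (eval x p) * pderiv j (X i), fun j => ?_, ?_⟩
    · simp [ha]; ring
    · simp only [map_mul, eval_X]
      fin_cases i <;> simp <;> linear_combination (X _) * ha'

/-- The point of the plane with sheared coordinates `(u, v)`. -/
def shearPoint (c u v : ℝ) : Fin 2 → ℝ := ![u + c * v, v]

@[simp] theorem shearPoint_zero (c u v : ℝ) : shearPoint c u v 0 = u + c * v := rfl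

@[simp] theorem shearPoint_one (c u v : ℝ) : shearPoint c u v 1 = v := rfl

theorem shearPoint_coords (c : ℝ) (p : Fin 2 → ℝ) : shearPoint c (p 0 - c * p 1) (p 1) = p := by
  ext i; fin_cases i <;> simp

theorem continuous_shearPoint (c : ℝ) : Continuous fun q : ℝ × ℝ => shearPoint c q.1 q.2 := by
  refine continuous_pi fun i => ?_
  fin_cases i
  · simp only [Fin.zero_eta, shearPoint_zero]; fun_prop
  · simp only [Fin.mk_one, shearPoint_one]; fun_prop

/-- The derivative of `F` along the fibers of the shear. -/
noncomputable def shearDeriv (c : ℝ) (F : MvPolynomial (Fin 2) ℝ) : MvPolynomial (Fin 2) ℝ :=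
  MvPolynomial.C c * MvPolynomial.pderiv 0 F + MvPolynomial.pderiv 1 F

theorem hasDerivAt_eval_shearPoint (c : ℝ) (F : MvPolynomial (Fin 2) ℝ) (u v : ℝ) :
    HasDerivAt (fun v => MvPolynomial.eval (shearPoint c u v) F)
      (MvPolynomial.eval (shearPoint c u v) (shearDeriv c F)) v := by
  have h := MvPolynomial.hasDerivAt_eval_comp (γ := fun v => shearPoint c u v) (γ' := ![c, 1])
    (t := v) (fun i => by
      fin_cases i
      · simpa using (((hasDerivAt_id v).const_mul c).const_add u)
      · exact hasDerivAt_id v) F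
  refine h.congr_deriv ?_
  simp [shearDeriv]; ring

theorem continuous_eval_shearPoint (c : ℝ) (F : MvPolynomial (Fin 2) ℝ) :
    Continuous fun q : ℝ × ℝ => MvPolynomial.eval (shearPoint c q.1 q.2) F :=
  (MvPolynomial.continuous_eval F).comp (continuous_shearPoint c)

/-- The restriction of `F` to a fiber of the shear. -/
noncomputable def fiberPoly (c : ℝ) (F : MvPolynomial (Fin 2) ℝ) (u : ℝ) : Polynomial ℝ :=
  MvPolynomial.aeval ![Polynomial.C u + Polynomial.C c * Polynomial.X, Polynomial.X] F

theorem eval_fiberPoly (c : ℝ) (F : MvPolynomial (Fin 2) ℝ) (u v : ℝ) :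
    (fiberPoly c F u).eval v = MvPolynomial.eval (shearPoint c u v) F := by
  induction F using MvPolynomial.induction_on with
  | C a => simp [fiberPoly]
  | add p q hp hq => simp only [fiberPoly, map_add, Polynomial.eval_add] at *; rw [hp, hq]
  | mul_X p i hp =>
    simp only [fiberPoly, map_mul, Polynomial.eval_mul, MvPolynomial.aeval_X,
      MvPolynomial.eval_X] at *
    rw [hp]
    fin_cases i <;> simp

theorem natDegree_fiberPoly_le (c : ℝ) (F : MvPolynomial (Fin 2) ℝ) (u : ℝ) :
    (fiberPoly c F u).natDegree ≤ F.totalDegree := by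
  have h := MvPolynomial.aeval_natDegree_le (m := F.totalDegree) (n := 1) F le_rfl
    ![Polynomial.C u + Polynomial.C c * Polynomial.X, Polynomial.X] (fun i => by
      fin_cases i
      · simp only [Fin.zero_eta, Matrix.cons_val_zero]; compute_degree
      · simp)
  simpa [fiberPoly] using h

theorem continuous_coeff_fiberPoly (c : ℝ) (F : MvPolynomial (Fin 2) ℝ) (i : ℕ) :
    Continuous fun u => (fiberPoly c F u).coeff i := by
  -- With `u` kept as an indeterminate, the coefficients become polynomials in `u`.
  let P : Polynomial (Polynomial ℝ) := MvPolynomial.aeval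
    ![Polynomial.C Polynomial.X + Polynomial.C (Polynomial.C c) * Polynomial.X, Polynomial.X] F
  have hP : ∀ u, fiberPoly c F u = P.map (Polynomial.evalRingHom u) := by
    intro u
    simp only [P, fiberPoly]
    induction F using MvPolynomial.induction_on with
    | C a => simp [IsScalarTower.algebraMap_apply ℝ (Polynomial ℝ) (Polynomial (Polynomial ℝ))]
    | add p q hp hq => simp only [map_add, Polynomial.map_add, hp, hq]
    | mul_X p i hp =>
      simp only [map_mul, Polynomial.map_mul, hp, MvPolynomial.aeval_X]
      fin_cases i <;> simp
  simp_rw [hP, Polynomial.coeff_map, Polynomial.coe_evalRingHom]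
  exact Polynomial.continuous _

/-- In a generic direction the restrictions of `F` to the fibers have constant leading term. -/
theorem exists_coeff_fiberPoly_ne_zero (F : MvPolynomial (Fin 2) ℝ) (hF : F ≠ 0) :
    ∃ c κ : ℝ, κ ≠ 0 ∧ ∀ u, (fiberPoly c F u).coeff F.totalDegree = κ := by
  classical
  set d := F.totalDegree with hd
  have hsum : ∀ n : Fin 2 →₀ ℕ, (n.sum fun _ e => e) = n 0 + n 1 := fun n => by
    rw [Finsupp.sum_fintype _ _ (fun _ => rfl), Fin.sum_univ_two]
  let T := F.support.filter fun e => e 0 + e 1 = d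
  -- `K.eval c` is the top-degree form of `F` at `(c, 1)`, which is the coefficient of `v ^ d` on
  -- every fiber. `K` is nonzero because monomials of degree `d` are told apart by their exponent in
  -- `X 0`.
  let K : Polynomial ℝ := ∑ e ∈ T, Polynomial.C (F.coeff e) * Polynomial.X ^ (e 0)
  have hK : K ≠ 0 := by
    obtain ⟨e, he, hed⟩ := Finset.exists_mem_eq_sup F.support
      (MvPolynomial.support_nonempty.2 hF) (fun s => s.sum fun _ e => e)
    have hed' : e 0 + e 1 = d := by rw [← hsum, hd, MvPolynomial.totalDegree, hed]
    intro h0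
    have h1 : K.coeff (e 0) = F.coeff e := by
      simp only [K, Polynomial.finsetSum_coeff, Polynomial.coeff_C_mul, Polynomial.coeff_X_pow]
      rw [Finset.sum_eq_single e]
      · simp
      · intro b hb hbe
        rw [if_neg, mul_zero]
        intro h
        have hb' := (Finset.mem_filter.1 hb).2
        refine hbe (Finsupp.ext fun i => ?_)
        fin_cases i
        · exact h.symm
        · change b 1 = e 1; omega
      · intro h
        exact absurd (Finset.mem_filter.2 ⟨he, hed'⟩) h
    rw [h0, Polynomial.coeff_zero] at h1
    exact MvPolynomial.mem_support_iff.1 he h1.symm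
  obtain ⟨c, hc⟩ : ∃ c, K.eval c ≠ 0 := by
    by_contra! h
    exact hK (Polynomial.funext fun x => by simp [h x])
  refine ⟨c, K.eval c, hc, fun u => ?_⟩
  rw [fiberPoly, MvPolynomial.aeval_def, MvPolynomial.eval₂_eq', Polynomial.finsetSum_coeff,
    Polynomial.eval_finsetSum, Finset.sum_filter]
  refine Finset.sum_congr rfl fun e he => ?_
  have hle : e 0 + e 1 ≤ d := by rw [← hsum]; exact MvPolynomial.le_totalDegree he
  have hlin : (Polynomial.C u + Polynomial.C c * Polynomial.X : Polynomial ℝ).natDegree ≤ 1 := by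
    compute_degree
  have hpow : ((Polynomial.C u + Polynomial.C c * Polynomial.X : Polynomial ℝ) ^ e 0).natDegree
      ≤ e 0 := by
    simpa using Polynomial.natDegree_pow_le_of_le (e 0) hlin
  rw [Fin.prod_univ_two, Polynomial.algebraMap_eq, Polynomial.coeff_C_mul]
  simp only [Matrix.cons_val_zero, Matrix.cons_val_one]
  split_ifs with h
  · rw [← h, Polynomial.coeff_mul_add_eq_of_natDegree_le hpow (Polynomial.natDegree_X_pow_le _)]
    have := Polynomial.coeff_pow_of_natDegree_le (m := e 0) hlin
    rw [mul_one] at this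
    rw [this]
    simp
  · rw [Polynomial.coeff_eq_zero_of_natDegree_lt, mul_zero]
    refine lt_of_le_of_lt (Polynomial.natDegree_mul_le_of_le hpow
      (Polynomial.natDegree_X_pow_le _)) (by omega)

end Shear

/-! ### Bad parameters and smooth branches of the curve -/

section Arcs

/-- An irreducible plane curve different from the coordinate axes, with a direction in which the
restrictions of its equation to lines have constant leading term. -/
structure IsGenericCurve (c : ℝ) (F : MvPolynomial (Fin 2) ℝ) : Prop where
  irreducible : Irreducible F
  not_dvd_X : ∀ i, ¬ F ∣ MvPolynomial.X i
  coeff : ∃ κ : ℝ, κ ≠ 0 ∧ ∀ u, (fiberPoly c F u).coeff F.totalDegree = κ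

/-- The polynomial vanishing on the curve `F = 0` at the points on the coordinate axes or with
tangent in the direction of the fibers. -/
noncomputable def badPoly (c : ℝ) (F : MvPolynomial (Fin 2) ℝ) : MvPolynomial (Fin 2) ℝ :=
  shearDeriv c F * (MvPolynomial.X 0 * MvPolynomial.X 1)

/-- The zeros of the restriction of `F` to a fiber. -/
noncomputable def fiberRoots (c : ℝ) (F : MvPolynomial (Fin 2) ℝ) (u : ℝ) : Finset ℝ :=
  (fiberPoly c F u).roots.toFinset

/-- A parameter is bad if its fiber contains a bad point of the curve. -/
def IsBadParam (c : ℝ) (F : MvPolynomial (Fin 2) ℝ) (u : ℝ) : Prop :=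
  ∃ v ∈ fiberRoots c F u, MvPolynomial.eval (shearPoint c u v) (badPoly c F) = 0

/-- The `i`-th branch of the curve over the parameter line. -/
noncomputable def branch (c : ℝ) (F : MvPolynomial (Fin 2) ℝ) (i : ℕ) (u : ℝ) : Fin 2 → ℝ :=
  shearPoint c u ((fiberRoots c F u).nthElement i)

namespace IsGenericCurve

variable {c : ℝ} {F : MvPolynomial (Fin 2) ℝ}

theorem totalDegree_pos (h : IsGenericCurve c F) : 1 ≤ F.totalDegree := by
  by_contra h0
  have h1 : F.totalDegree = 0 := by omega
  rw [MvPolynomial.totalDegree_eq_zero_iff_eq_C] at h1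
  refine h.irreducible.not_isUnit ?_
  rw [h1]
  refine (isUnit_iff_ne_zero.2 fun h2 => h.irreducible.ne_zero ?_).map MvPolynomial.C
  rw [h1, h2, map_zero]

theorem natDegree_fiberPoly (h : IsGenericCurve c F) (u : ℝ) :
    (fiberPoly c F u).natDegree = F.totalDegree := by
  obtain ⟨κ, hκ, hc⟩ := h.coeff
  refine le_antisymm (natDegree_fiberPoly_le c F u) (Polynomial.le_natDegree_of_ne_zero ?_)
  rwa [hc]

theorem fiberPoly_ne_zero (h : IsGenericCurve c F) (u : ℝ) : fiberPoly c F u ≠ 0 := by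
  intro h0
  have h1 := h.natDegree_fiberPoly u
  have h2 := h.totalDegree_pos
  rw [h0, Polynomial.natDegree_zero] at h1
  omega

theorem mem_fiberRoots (h : IsGenericCurve c F) (u v : ℝ) :
    v ∈ fiberRoots c F u ↔ MvPolynomial.eval (shearPoint c u v) F = 0 := by
  rw [fiberRoots, Multiset.mem_toFinset, Polynomial.mem_roots (h.fiberPoly_ne_zero u),
    Polynomial.IsRoot.def, eval_fiberPoly]

theorem card_fiberRoots_le (h : IsGenericCurve c F) (u : ℝ) :
    (fiberRoots c F u).card ≤ F.totalDegree := by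
  rw [← h.natDegree_fiberPoly u]
  exact (Multiset.toFinset_card_le _).trans (Polynomial.card_roots' _)

/-- Otherwise the fiber polynomial would have zero derivative, although its degree is positive. -/
theorem shearDeriv_ne_zero (h : IsGenericCurve c F) : shearDeriv c F ≠ 0 := by
  intro h0
  have hder : Polynomial.derivative (fiberPoly c F 0) = 0 := by
    refine Polynomial.funext fun v => ?_
    have h1 := (fiberPoly c F 0).hasDerivAt v
    simp_rw [eval_fiberPoly] at h1
    rw [h1.unique (hasDerivAt_eval_shearPoint c F 0 v), h0]
    simp
  have := Polynomial.derivative_eq_zero.1 hder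
  rw [h.natDegree_fiberPoly] at this
  have := h.totalDegree_pos
  omega

theorem totalDegree_shearDeriv_le (c : ℝ) (F : MvPolynomial (Fin 2) ℝ) :
    (shearDeriv c F).totalDegree ≤ F.totalDegree - 1 := by
  refine (MvPolynomial.totalDegree_add _ _).trans (max_le ?_ ?_)
  · refine (MvPolynomial.totalDegree_mul _ _).trans ?_
    rw [MvPolynomial.totalDegree_C, zero_add]
    exact MvPolynomial.totalDegree_pderiv_le _ _
  · exact MvPolynomial.totalDegree_pderiv_le _ _

/-- `F` is prime, `shearDeriv c F` is nonzero of smaller degree, and the curve is not an axis. -/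
theorem not_dvd_badPoly (h : IsGenericCurve c F) : ¬ F ∣ badPoly c F := by
  intro hd
  rcases h.irreducible.prime.dvd_or_dvd hd with h1 | h1
  · have h2 := MvPolynomial.totalDegree_le_of_dvd_of_isDomain h1 h.shearDeriv_ne_zero
    have h3 := totalDegree_shearDeriv_le c F
    have h4 := h.totalDegree_pos
    omega
  · rcases h.irreducible.prime.dvd_or_dvd h1 with h2 | h2
    · exact h.not_dvd_X _ h2
    · exact h.not_dvd_X _ h2

theorem totalDegree_badPoly_le (h : IsGenericCurve c F) :
    (badPoly c F).totalDegree ≤ F.totalDegree + 1 := by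
  have h3 := totalDegree_shearDeriv_le c F
  have h4 := h.totalDegree_pos
  have hX : (MvPolynomial.X 0 * MvPolynomial.X 1 : MvPolynomial (Fin 2) ℝ).totalDegree ≤ 2 :=
    (MvPolynomial.totalDegree_mul _ _).trans (by simp)
  refine (MvPolynomial.totalDegree_mul _ _).trans ?_
  omega

theorem setOf_isBadParam (h : IsGenericCurve c F) : {u | IsBadParam c F u} =
    (fun p : Fin 2 → ℝ => p 0 - c * p 1) ''
      {p | MvPolynomial.eval p F = 0 ∧ MvPolynomial.eval p (badPoly c F) = 0} := by
  ext u
  constructor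
  · rintro ⟨v, hv, hb⟩
    exact ⟨_, ⟨(h.mem_fiberRoots u v).1 hv, hb⟩, by simp⟩
  · rintro ⟨p, ⟨hp, hb⟩, rfl⟩
    refine ⟨p 1, (h.mem_fiberRoots _ _).2 ?_, ?_⟩
    · simpa only [shearPoint_coords] using hp
    · simpa only [shearPoint_coords] using hb

theorem finite_isBadParam (h : IsGenericCurve c F) : {u | IsBadParam c F u}.Finite := by
  rw [h.setOf_isBadParam]
  exact (commonZeros_finite h.irreducible h.not_dvd_badPoly).image _

/-- The finite set of bad parameters. -/
noncomputable def badParams (h : IsGenericCurve c F) : Finset ℝ := h.finite_isBadParam.toFinset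

theorem mem_badParams (h : IsGenericCurve c F) (u : ℝ) :
    u ∈ h.badParams ↔ IsBadParam c F u := by
  simp [badParams]

theorem card_badParams_le (h : IsGenericCurve c F) :
    h.badParams.card ≤ F.totalDegree * (F.totalDegree + 1) := by
  rw [badParams, ← Set.ncard_eq_toFinset_card _ h.finite_isBadParam, h.setOf_isBadParam]
  exact (Set.ncard_image_le (commonZeros_finite h.irreducible h.not_dvd_badPoly)).trans
    (ncard_commonZeros_le h.irreducible rfl h.not_dvd_badPoly h.totalDegree_badPoly_le)

/-- Cauchy's root bound is locally uniform, since the leading coefficient is constant and the others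
are continuous in `u`. -/
theorem exists_bound_fiberRoots (h : IsGenericCurve c F) (u₀ : ℝ) :
    ∃ M, ∀ᶠ u in 𝓝 u₀, ∀ v, MvPolynomial.eval (shearPoint c u v) F = 0 → |v| ≤ M := by
  obtain ⟨κ, hκ, hc⟩ := h.coeff
  have hev : ∀ᶠ u in 𝓝 u₀, ∀ i ∈ Finset.range F.totalDegree,
      ‖(fiberPoly c F u).coeff i‖₊ ≤ ‖(fiberPoly c F u₀).coeff i‖₊ + 1 := by
    refine (Finset.eventually_all _).2 fun i _ => ?_
    have : Continuous fun u => ‖(fiberPoly c F u).coeff i‖₊ :=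
      (continuous_coeff_fiberPoly c F i).nnnorm
    exact (this.continuousAt.eventually_lt continuousAt_const (by simp)).mono fun _ h => h.le
  refine ⟨((Finset.sup (Finset.range F.totalDegree)
    (fun i => ‖(fiberPoly c F u₀).coeff i‖₊ + 1) / ‖κ‖₊ + 1 : NNReal) : ℝ), ?_⟩
  filter_upwards [hev] with u hu v hv
  have hroot : (fiberPoly c F u).IsRoot v := by rw [Polynomial.IsRoot.def, eval_fiberPoly, hv]
  have hb := (hroot.norm_lt_cauchyBound (h.fiberPoly_ne_zero u)).le
  rw [Polynomial.cauchyBound, Polynomial.leadingCoeff, h.natDegree_fiberPoly, hc] at hb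
  have : ‖v‖₊ ≤ Finset.sup (Finset.range F.totalDegree)
      (fun i => ‖(fiberPoly c F u₀).coeff i‖₊ + 1) / ‖κ‖₊ + 1 := by
    refine hb.trans ?_
    gcongr with i hi
    exact hu i hi
  exact_mod_cast this

theorem eval_shearDeriv_ne_zero {u v : ℝ} (hu : ¬ IsBadParam c F u) (hv : v ∈ fiberRoots c F u) :
    MvPolynomial.eval (shearPoint c u v) (shearDeriv c F) ≠ 0 := fun h0 =>
  hu ⟨v, hv, by rw [badPoly, map_mul, h0, zero_mul]⟩

theorem card_fiberRoots_eq (h : IsGenericCurve c F) {a b x y : ℝ}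
    (hab : ∀ u ∈ Set.Icc a b, ¬ IsBadParam c F u) (hx : x ∈ Set.Icc a b) (hy : y ∈ Set.Icc a b) :
    (fiberRoots c F x).card = (fiberRoots c F y).card :=
  card_eq_of_simple_on_Icc (continuous_eval_shearPoint c F)
    (continuous_eval_shearPoint c (shearDeriv c F)) (hasDerivAt_eval_shearPoint c F)
    h.mem_fiberRoots h.exists_bound_fiberRoots
    (fun _ hu _ hv => eval_shearDeriv_ne_zero (hab _ hu) hv) hx hy

theorem eventually_card_fiberRoots_eq (h : IsGenericCurve c F) {x : ℝ}
    (hx : ¬ IsBadParam c F x) :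
    ∀ᶠ u in 𝓝 x, (fiberRoots c F u).card = (fiberRoots c F x).card :=
  eventually_card_eq_of_simple (continuous_eval_shearPoint c F)
    (continuous_eval_shearPoint c (shearDeriv c F)) (hasDerivAt_eval_shearPoint c F)
    h.mem_fiberRoots x (h.exists_bound_fiberRoots x)
    (fun _ hv => eval_shearDeriv_ne_zero hx hv)

theorem continuousAt_nthElement (h : IsGenericCurve c F) {x : ℝ} (hx : ¬ IsBadParam c F x)
    {i : ℕ} (hi : i < (fiberRoots c F x).card) :
    ContinuousAt (fun u => (fiberRoots c F u).nthElement i) x :=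
  continuousAt_nthElement_of_simple (continuous_eval_shearPoint c F)
    (continuous_eval_shearPoint c (shearDeriv c F)) (hasDerivAt_eval_shearPoint c F)
    h.mem_fiberRoots x (h.exists_bound_fiberRoots x)
    (fun _ hv => eval_shearDeriv_ne_zero hx hv) hi

theorem eval_branch (h : IsGenericCurve c F) {x : ℝ} {i : ℕ}
    (hi : i < (fiberRoots c F x).card) : MvPolynomial.eval (branch c F i x) F = 0 :=
  (h.mem_fiberRoots _ _).1 (Finset.nthElement_mem hi)

/-- Implicit differentiation. Hadamard's lemma at the base point, evaluated along the branch where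
`F` vanishes, expresses the difference quotient as a ratio of continuous functions. -/
theorem hasDerivAt_nthElement (h : IsGenericCurve c F) {x : ℝ} (hx : ¬ IsBadParam c F x)
    {i : ℕ} (hi : i < (fiberRoots c F x).card) :
    HasDerivAt (fun u => (fiberRoots c F u).nthElement i)
      (-MvPolynomial.eval (branch c F i x) (MvPolynomial.pderiv 0 F) /
        MvPolynomial.eval (branch c F i x) (shearDeriv c F)) x := by
  set φ : ℝ → ℝ := fun u => (fiberRoots c F u).nthElement i with hφ
  have hcont : ContinuousAt φ x := h.continuousAt_nthElement hx hi
  have hne : MvPolynomial.eval (branch c F i x) (shearDeriv c F) ≠ 0 :=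
    eval_shearDeriv_ne_zero hx (Finset.nthElement_mem hi)
  obtain ⟨a, ha, haF⟩ := F.exists_sub_eval_eq (branch c F i x)
  have hbr : ∀ p : MvPolynomial (Fin 2) ℝ,
      ContinuousAt (fun t => MvPolynomial.eval (branch c F i t) p) x := fun p =>
    ContinuousAt.comp (f := fun t => (t, φ t)) (continuous_eval_shearPoint c p).continuousAt
      (continuousAt_id.prodMk hcont)
  have hlim : Tendsto (fun t => -MvPolynomial.eval (branch c F i t) (a 0) /
      MvPolynomial.eval (branch c F i t) (MvPolynomial.C c * a 0 + a 1)) (𝓝[≠] x)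
      (𝓝 (-MvPolynomial.eval (branch c F i x) (MvPolynomial.pderiv 0 F) /
        MvPolynomial.eval (branch c F i x) (shearDeriv c F))) := by
    have e1 : MvPolynomial.eval (branch c F i x) (MvPolynomial.C c * a 0 + a 1) =
        MvPolynomial.eval (branch c F i x) (shearDeriv c F) := by
      simp [shearDeriv, ha]
    rw [← ha 0, ← e1]
    refine Tendsto.mono_left ?_ nhdsWithin_le_nhds
    exact (hbr (a 0)).neg.div (hbr _) (by rw [e1]; exact hne)
  rw [hasDerivAt_iff_tendsto_slope]
  refine hlim.congr' ?_
  have hnear : ∀ᶠ t in 𝓝 x,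
      MvPolynomial.eval (branch c F i t) (MvPolynomial.C c * a 0 + a 1) ≠ 0 := by
    refine (hbr _).eventually_ne ?_
    simpa [shearDeriv, ha] using hne
  filter_upwards [self_mem_nhdsWithin, nhdsWithin_le_nhds hnear,
    nhdsWithin_le_nhds (h.eventually_card_fiberRoots_eq hx)] with t htx ht hcard
  have hFt : MvPolynomial.eval (branch c F i t) F = 0 := h.eval_branch (by rwa [hcard])
  have hid := congrArg (MvPolynomial.eval (branch c F i t)) haF
  rw [h.eval_branch hi] at hid
  simp only [map_sub, map_add, map_mul, MvPolynomial.eval_X, MvPolynomial.eval_C, hFt] at hid ht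
  have b0 : ∀ s, branch c F i s 0 = s + c * φ s := fun s => rfl
  have b1 : ∀ s, branch c F i s 1 = φ s := fun s => rfl
  rw [b0, b0, b1, b1] at hid
  have htx' : t - x ≠ 0 := sub_ne_zero.2 htx
  rw [slope_def_field]
  simp only [map_add, map_mul, MvPolynomial.eval_C]
  rw [div_eq_div_iff ht htx']
  linear_combination hid

/-- Along a branch, every polynomial is differentiable, and its derivative is a nonvanishing
multiple of its Hamiltonian derivative. -/
theorem exists_hasDerivAt_eval_branch (h : IsGenericCurve c F) {x : ℝ}
    (hx : ¬ IsBadParam c F x) {i : ℕ} (hi : i < (fiberRoots c F x).card) :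
    ∃ ρ : ℝ, ρ ≠ 0 ∧ ∀ p : MvPolynomial (Fin 2) ℝ,
      HasDerivAt (fun t => MvPolynomial.eval (branch c F i t) p)
        (ρ * MvPolynomial.eval (branch c F i x) (hamiltonian F p)) x := by
  have hbad : MvPolynomial.eval (branch c F i x) (badPoly c F) ≠ 0 := fun h0 =>
    hx ⟨_, Finset.nthElement_mem hi, h0⟩
  have hφ := h.hasDerivAt_nthElement hx hi
  -- The velocity of the branch is `(F_Y, -F_X) / shearDeriv c F`, and the Hamiltonian derivation
  -- carries the further factor `X * Y`.
  refine ⟨(MvPolynomial.eval (branch c F i x) (badPoly c F))⁻¹, inv_ne_zero hbad, fun p => ?_⟩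
  set r := -MvPolynomial.eval (branch c F i x) (MvPolynomial.pderiv 0 F) /
    MvPolynomial.eval (branch c F i x) (shearDeriv c F) with hr
  have hγ := MvPolynomial.hasDerivAt_eval_comp (γ := branch c F i) (γ' := ![1 + c * r, r])
    (t := x) (fun j => by
      fin_cases j
      · exact (hasDerivAt_id x).add (hφ.const_mul c)
      · exact hφ) p
  refine hγ.congr_deriv ?_
  rw [badPoly, map_mul, mul_ne_zero_iff, map_mul, mul_ne_zero_iff] at hbad
  obtain ⟨n1, n2, n3⟩ := hbad
  rw [hamiltonian_apply, badPoly]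
  simp only [map_mul, map_sub, Matrix.cons_val_zero, Matrix.cons_val_one]
  rw [hr]
  field_simp
  simp only [shearDeriv, map_add, map_mul, MvPolynomial.eval_C]
  ring

end IsGenericCurve

end Arcs

/-! ### Rolle's theorem on the curve -/

section Rolle

theorem Finset.rankBelow_mono (s : Finset ℝ) : Monotone s.rankBelow := fun _ _ h =>
  Finset.card_le_card fun _ hx =>
    Finset.mem_filter.2 ⟨(Finset.mem_filter.1 hx).1, (Finset.mem_filter.1 hx).2.trans_le h⟩

/-- The points of the curve `F = 0` outside the bad fibers at which `p` vanishes. -/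
def goodZeros (c : ℝ) (F p : MvPolynomial (Fin 2) ℝ) : Set (Fin 2 → ℝ) :=
  {x | MvPolynomial.eval x F = 0 ∧ ¬ IsBadParam c F (x 0 - c * x 1) ∧ MvPolynomial.eval x p = 0}

namespace IsGenericCurve

variable {c : ℝ} {F : MvPolynomial (Fin 2) ℝ}

@[simp]
theorem param_branch (i : ℕ) (t : ℝ) : branch c F i t 0 - c * branch c F i t 1 = t := by
  simp [branch]

theorem injective_branch (i : ℕ) : Function.Injective (branch c F i) := fun s t hst => by
  rw [← param_branch (c := c) (F := F) i s, hst, param_branch]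

theorem snd_mem_fiberRoots (h : IsGenericCurve c F) {x : Fin 2 → ℝ}
    (hx : MvPolynomial.eval x F = 0) : x 1 ∈ fiberRoots c F (x 0 - c * x 1) := by
  rw [h.mem_fiberRoots, shearPoint_coords, hx]

theorem branch_rankBelow (h : IsGenericCurve c F) {x : Fin 2 → ℝ}
    (hx : MvPolynomial.eval x F = 0) :
    branch c F ((fiberRoots c F (x 0 - c * x 1)).rankBelow (x 1)) (x 0 - c * x 1) = x := by
  rw [branch, Finset.nthElement_rankBelow (h.snd_mem_fiberRoots hx), shearPoint_coords]

/-- The counting form of Rolle's theorem on a plane curve. -/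
theorem card_le_of_interleaved (h : IsGenericCurve c F) (S T : Finset (Fin 2 → ℝ))
    (hS : ∀ x ∈ S, MvPolynomial.eval x F = 0 ∧ ¬ IsBadParam c F (x 0 - c * x 1))
    (hST : ∀ (i : ℕ) (a b : ℝ), a < b → (∀ u ∈ Set.Icc a b, ¬ IsBadParam c F u) →
      i < (fiberRoots c F a).card → branch c F i a ∈ S → branch c F i b ∈ S →
      ∃ t ∈ Set.Ioo a b, branch c F i t ∈ T) :
    S.card ≤ T.card + (h.badParams.card + 1) * F.totalDegree := by
  classical
  let π : (Fin 2 → ℝ) → ℝ := fun x => x 0 - c * x 1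
  -- A class is an arc: the gap between bad parameters, then the position in the fiber. On each arc
  -- `S` has at most one more point than `T`.
  let cl : (Fin 2 → ℝ) → ℕ × ℕ := fun x =>
    (h.badParams.rankBelow (π x), (fiberRoots c F (π x)).rankBelow (x 1))
  let J : Finset (ℕ × ℕ) := Finset.range (h.badParams.card + 1) ×ˢ Finset.range F.totalDegree
  have hJ : ∀ x ∈ S, cl x ∈ J := by
    intro x hx
    refine Finset.mem_product.2 ⟨Finset.mem_range.2 ?_, Finset.mem_range.2 ?_⟩
    · exact Nat.lt_succ_of_le (Finset.card_le_card (Finset.filter_subset _ _))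
    · exact (Finset.rankBelow_lt_card (h.snd_mem_fiberRoots (hS x hx).1)).trans_le
        (h.card_fiberRoots_le _)
  have hclass : ∀ k ∈ J, (S.filter fun x => cl x = k).card ≤
      (T.filter fun x => cl x = k).card + 1 := by
    intro k _
    have hrec : ∀ x ∈ S.filter fun x => cl x = k, x = branch c F k.2 (π x) := by
      intro x hx
      obtain ⟨hxS, hxk⟩ := Finset.mem_filter.1 hx
      rw [← hxk]
      exact (h.branch_rankBelow (hS x hxS).1).symm
    have hinj : Set.InjOn π (S.filter fun x => cl x = k) := by
      intro x hx y hy hxy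
      rw [hrec x hx, hrec y hy, hxy]
    rw [← Finset.card_image_of_injOn hinj]
    refine (Finset.card_le_of_interleaved (t := (T.filter fun x => cl x = k).image π) ?_).trans
      (Nat.succ_le_succ Finset.card_image_le)
    intro a ha b hb hab _
    obtain ⟨x, hx, rfl⟩ := Finset.mem_image.1 ha
    obtain ⟨y, hy, rfl⟩ := Finset.mem_image.1 hb
    obtain ⟨hxS, hxk⟩ := Finset.mem_filter.1 hx
    obtain ⟨hyS, hyk⟩ := Finset.mem_filter.1 hy
    have rx : h.badParams.rankBelow (π x) = k.1 := congrArg Prod.fst hxk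
    have ry : h.badParams.rankBelow (π y) = k.1 := congrArg Prod.fst hyk
    have hgood : ∀ u ∈ Set.Icc (π x) (π y), ¬ IsBadParam c F u := by
      intro u hu hbad
      -- The rank counts strictly smaller bad parameters, so it does not detect a bad right
      -- endpoint.
      have hne : u ≠ π y := by
        rintro rfl
        exact (hS y hyS).2 hbad
      have h1 := h.badParams.rankBelow_mono hu.1
      have h2 := Finset.rankBelow_lt_of_lt ((h.mem_badParams u).2 hbad) (lt_of_le_of_ne hu.2 hne)
      omega
    have hcard : k.2 < (fiberRoots c F (π x)).card := by
      rw [← hxk]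
      exact Finset.rankBelow_lt_card (h.snd_mem_fiberRoots (hS x hxS).1)
    obtain ⟨t, ht, htT⟩ := hST k.2 (π x) (π y) hab hgood hcard (by rw [← hrec x hx]; exact hxS)
      (by rw [← hrec y hy]; exact hyS)
    refine ⟨t, Finset.mem_image.2 ⟨_, Finset.mem_filter.2 ⟨htT, Prod.ext ?_ ?_⟩,
      param_branch _ _⟩, ht⟩
    · change h.badParams.rankBelow (branch c F k.2 t 0 - c * branch c F k.2 t 1) = k.1
      rw [param_branch]
      have h1 := h.badParams.rankBelow_mono ht.1.le
      have h2 := h.badParams.rankBelow_mono ht.2.le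
      omega
    · change (fiberRoots c F (branch c F k.2 t 0 - c * branch c F k.2 t 1)).rankBelow
        (branch c F k.2 t 1) = k.2
      rw [param_branch]
      refine Finset.rankBelow_nthElement ?_
      rwa [← h.card_fiberRoots_eq hgood ⟨le_rfl, hab.le⟩ (Set.Ioo_subset_Icc_self ht)]
  calc S.card = ∑ k ∈ J, (S.filter fun x => cl x = k).card :=
        Finset.card_eq_sum_card_fiberwise hJ
    _ ≤ ∑ k ∈ J, ((T.filter fun x => cl x = k).card + 1) := Finset.sum_le_sum hclass
    _ = ∑ k ∈ J, (T.filter fun x => cl x = k).card + J.card := by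
        rw [Finset.sum_add_distrib, Finset.sum_const, smul_eq_mul, mul_one]
    _ ≤ T.card + (h.badParams.card + 1) * F.totalDegree := by
        refine Nat.add_le_add ?_ ?_
        · rw [← Finset.card_biUnion]
          · exact Finset.card_le_card (Finset.biUnion_subset.2 fun k _ => Finset.filter_subset _ _)
          · intro k _ l _ hkl
            refine Finset.disjoint_left.2 fun x hx hy => hkl ?_
            rw [← (Finset.mem_filter.1 hx).2, (Finset.mem_filter.1 hy).2]
        · simp [J]

theorem finite_goodZeros (h : IsGenericCurve c F) {p : MvPolynomial (Fin 2) ℝ} (hp : ¬ F ∣ p) :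
    (goodZeros c F p).Finite :=
  (commonZeros_finite h.irreducible hp).subset fun _ hx => ⟨hx.1, hx.2.2⟩

/-- One step of the elimination: comparing the zeros of `P` with those of a polynomial `Q` such
that `V * Q` is the numerator of the derivative of `P / W`. -/
theorem ncard_goodZeros_le (h : IsGenericCurve c F) {P Q V W : MvPolynomial (Fin 2) ℝ}
    (hP : ¬ F ∣ P) (hQ : ¬ F ∣ Q) (hV : ¬ F ∣ V) (hW : ¬ F ∣ W)
    (hid : V * Q = W * hamiltonian F P - P * hamiltonian F W) :
    (goodZeros c F P).ncard ≤ (goodZeros c F Q).ncard + (goodZeros c F V).ncard +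
      2 * (goodZeros c F W).ncard + (h.badParams.card + 1) * F.totalDegree := by
  classical
  have fP := h.finite_goodZeros hP
  have fQ := h.finite_goodZeros hQ
  have fV := h.finite_goodZeros hV
  have fW := h.finite_goodZeros hW
  rw [Set.ncard_eq_toFinset_card _ fP, Set.ncard_eq_toFinset_card _ fQ,
    Set.ncard_eq_toFinset_card _ fV, Set.ncard_eq_toFinset_card _ fW]
  -- Zeros of `W` are paid for twice: they are removed from those of `P`, where the quotient is
  -- undefined, and they serve as separators on arcs where Rolle does not apply to `P / W`.
  have key := h.card_le_of_interleaved (fP.toFinset \ fW.toFinset)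
    (fQ.toFinset ∪ fV.toFinset ∪ fW.toFinset) ?_ ?_
  · have h1 := Finset.card_le_card_sdiff_add_card (s := fP.toFinset) (t := fW.toFinset)
    have h2 := Finset.card_union_le (fQ.toFinset ∪ fV.toFinset) fW.toFinset
    have h3 := Finset.card_union_le fQ.toFinset fV.toFinset
    omega
  · intro x hx
    have := (Finset.mem_sdiff.1 hx).1
    rw [Set.Finite.mem_toFinset] at this
    exact ⟨this.1, this.2.1⟩
  · intro i a b hab hgood hcard ha hb
    simp only [Finset.mem_sdiff, Set.Finite.mem_toFinset] at ha hb
    simp only [Finset.mem_union, Set.Finite.mem_toFinset]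
    have hcard' : ∀ t ∈ Set.Icc a b, i < (fiberRoots c F t).card := fun t ht => by
      rwa [← h.card_fiberRoots_eq hgood ⟨le_rfl, hab.le⟩ ht]
    have hmem : ∀ t ∈ Set.Icc a b, ∀ p, MvPolynomial.eval (branch c F i t) p = 0 →
        branch c F i t ∈ goodZeros c F p := fun t ht p hp =>
      ⟨h.eval_branch (hcard' t ht), by rw [param_branch]; exact hgood t ht, hp⟩
    by_cases hW0 : ∃ t ∈ Set.Ioo a b, MvPolynomial.eval (branch c F i t) W = 0
    · obtain ⟨t, ht, ht0⟩ := hW0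
      exact ⟨t, ht, Or.inr (hmem t (Set.Ioo_subset_Icc_self ht) W ht0)⟩
    · push Not at hW0
      have hWne : ∀ t ∈ Set.Icc a b, MvPolynomial.eval (branch c F i t) W ≠ 0 := by
        intro t ht h0
        rcases eq_or_lt_of_le ht.1 with e | e
        · subst e; exact ha.2 (hmem _ ht _ h0)
        rcases eq_or_lt_of_le ht.2 with e' | e'
        · subst e'; exact hb.2 (hmem _ ht _ h0)
        exact hW0 t ⟨e, e'⟩ h0
      have hder : ∀ t ∈ Set.Icc a b, ∃ ρ : ℝ, ρ ≠ 0 ∧ HasDerivAt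
          (fun s => MvPolynomial.eval (branch c F i s) P / MvPolynomial.eval (branch c F i s) W)
          (ρ * MvPolynomial.eval (branch c F i t) (V * Q)) t := by
        intro t ht
        obtain ⟨ρ, hρ, hd⟩ := h.exists_hasDerivAt_eval_branch (hgood t ht) (hcard' t ht)
        have hw := hWne t ht
        refine ⟨ρ / MvPolynomial.eval (branch c F i t) W ^ 2, by positivity, ?_⟩
        refine ((hd P).div (hd W) hw).congr_deriv ?_
        rw [hid, map_sub, map_mul, map_mul]
        ring
      choose! ρ hρ hd using hder
      obtain ⟨t, ht, ht0⟩ := exists_hasDerivAt_eq_zero hab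
        (fun t ht => (hd t ht).continuousAt.continuousWithinAt)
        (by rw [ha.1.2.2, hb.1.2.2]; simp) (fun t ht => hd t (Set.Ioo_subset_Icc_self ht))
      have ht' := Set.Ioo_subset_Icc_self ht
      refine ⟨t, ht, Or.inl ?_⟩
      have := (mul_eq_zero.1 ht0).resolve_left (hρ t ht')
      rw [map_mul, mul_eq_zero] at this
      rcases this with h0 | h0
      · exact Or.inr (hmem t ht' V h0)
      · exact Or.inl (hmem t ht' Q h0)

/-- An arc has infinitely many points, more than Bézout allows when `F` does not divide `p`. -/
theorem dvd_of_eval_branch_eq_zero (h : IsGenericCurve c F) {p : MvPolynomial (Fin 2) ℝ}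
    {i : ℕ} {a b : ℝ} (hab : a < b)
    (hcurve : ∀ t ∈ Set.Ioo a b, MvPolynomial.eval (branch c F i t) F = 0)
    (hp : ∀ t ∈ Set.Ioo a b, MvPolynomial.eval (branch c F i t) p = 0) : F ∣ p := by
  by_contra hnd
  have hinf : (branch c F i '' Set.Ioo a b).Infinite :=
    (Set.Ioo_infinite hab).image (injective_branch i).injOn
  refine hinf ((commonZeros_finite h.irreducible hnd).subset ?_)
  rintro _ ⟨t, ht, rfl⟩
  exact ⟨hcurve t ht, hp t ht⟩

/-- Near a good point there is an arc of the curve avoiding the zeros of a given polynomial. -/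
theorem exists_arc (h : IsGenericCurve c F) {x : Fin 2 → ℝ} (hx : MvPolynomial.eval x F = 0)
    (hgood : ¬ IsBadParam c F (x 0 - c * x 1)) {W : MvPolynomial (Fin 2) ℝ} (hW : ¬ F ∣ W) :
    ∃ (i : ℕ) (a b : ℝ), a < b ∧ ∀ t ∈ Set.Ioo a b, ¬ IsBadParam c F t ∧
      i < (fiberRoots c F t).card ∧ MvPolynomial.eval (branch c F i t) W ≠ 0 := by
  set u := x 0 - c * x 1 with hu
  set i := (fiberRoots c F u).rankBelow (x 1) with hi
  set E : Set ℝ := {u | IsBadParam c F u} ∪ (fun p : Fin 2 → ℝ => p 0 - c * p 1) ''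
    {p | MvPolynomial.eval p F = 0 ∧ MvPolynomial.eval p W = 0} with hEdef
  have hE : E.Finite :=
    h.finite_isBadParam.union ((commonZeros_finite h.irreducible hW).image _)
  -- `W` may vanish at `x`, so `u` may lie in `E`. The arc starts strictly to the right of `u`.
  have hE' : (E \ {u})ᶜ ∈ 𝓝 u :=
    (hE.subset Set.sdiff_subset).isClosed.isOpen_compl.mem_nhds (by simp)
  have hcard : i < (fiberRoots c F u).card :=
    Finset.rankBelow_lt_card (h.snd_mem_fiberRoots hx)
  have hev : ∀ᶠ t in 𝓝[>] u, ¬ IsBadParam c F t ∧ i < (fiberRoots c F t).card ∧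
      MvPolynomial.eval (branch c F i t) W ≠ 0 := by
    filter_upwards [self_mem_nhdsWithin, nhdsWithin_le_nhds hE',
      nhdsWithin_le_nhds (h.eventually_card_fiberRoots_eq hgood)] with t htu htE htc
    have hne : t ≠ u := ne_of_gt htu
    have hc : i < (fiberRoots c F t).card := by rwa [htc]
    refine ⟨fun hb => htE ⟨Or.inl hb, hne⟩, hc, fun hw => htE ⟨Or.inr ?_, hne⟩⟩
    exact ⟨_, ⟨h.eval_branch hc, hw⟩, param_branch i t⟩
  obtain ⟨b, hb, hbE⟩ := mem_nhdsGT_iff_exists_Ioo_subset.1 hev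
  exact ⟨i, u, b, hb, fun t ht => hbE ht⟩

theorem infinite_zeros (h : IsGenericCurve c F) {x : Fin 2 → ℝ} (hx : MvPolynomial.eval x F = 0)
    (hgood : ¬ IsBadParam c F (x 0 - c * x 1)) : {x | MvPolynomial.eval x F = 0}.Infinite := by
  obtain ⟨i, a, b, hab, harc⟩ := h.exists_arc hx hgood h.not_dvd_badPoly
  have hinf : (branch c F i '' Set.Ioo a b).Infinite :=
    (Set.Ioo_infinite hab).image (injective_branch i).injOn
  refine hinf.mono ?_
  rintro _ ⟨t, ht, rfl⟩
  exact h.eval_branch (harc t ht).2.1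

/-- If the logarithmic derivatives of `P` and `W` agree on the curve, then `P` is a constant
multiple of `W` on the curve. -/
theorem exists_dvd_sub_smul (h : IsGenericCurve c F) {x : Fin 2 → ℝ}
    (hx : MvPolynomial.eval x F = 0) (hgood : ¬ IsBadParam c F (x 0 - c * x 1))
    {P W : MvPolynomial (Fin 2) ℝ} (hW : ¬ F ∣ W)
    (hid : F ∣ W * hamiltonian F P - P * hamiltonian F W) : ∃ r : ℝ, F ∣ P - r • W := by
  obtain ⟨i, a, b, hab, harc⟩ := h.exists_arc hx hgood hW
  have hcurve : ∀ t ∈ Set.Ioo a b, MvPolynomial.eval (branch c F i t) F = 0 := fun t ht =>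
    h.eval_branch (harc t ht).2.1
  have hd : ∀ t ∈ Set.Ioo a b, HasDerivAt
      (fun s => MvPolynomial.eval (branch c F i s) P / MvPolynomial.eval (branch c F i s) W)
      0 t := by
    intro t ht
    obtain ⟨h1, h2, hw⟩ := harc t ht
    obtain ⟨ρ, hρ, hd⟩ := h.exists_hasDerivAt_eval_branch h1 h2
    refine ((hd P).div (hd W) hw).congr_deriv ?_
    obtain ⟨q, hq⟩ := hid
    have := congrArg (MvPolynomial.eval (branch c F i t)) hq
    rw [map_mul, hcurve t ht, zero_mul, map_sub, map_mul, map_mul] at this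
    rw [div_eq_zero_iff]
    left
    linear_combination ρ * this
  obtain ⟨r, hr⟩ := isOpen_Ioo.exists_is_const_of_deriv_eq_zero isPreconnected_Ioo
    (fun t ht => (hd t ht).differentiableAt.differentiableWithinAt) (fun t ht => (hd t ht).deriv)
  refine ⟨r, h.dvd_of_eval_branch_eq_zero hab hcurve fun t ht => ?_⟩
  have := hr t ht
  rw [div_eq_iff (harc t ht).2.2] at this
  rw [map_sub, MvPolynomial.smul_eval, this, sub_self]

end IsGenericCurve

end Rolle

/-! ### Independent monomials, nonvanishing Wronskians and the count -/

section Counting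

/-- The last term moves into the vacant slot `k`. -/
theorem Finset.exists_sum_range_eq_of_eq_zero {α M : Type*} [AddCommMonoid M] (n k : ℕ)
    (hk : k < n + 1) (g : ℕ → α) (w : α → M) (h0 : w (g k) = 0) :
    ∃ g' : ℕ → α, ∑ j ∈ Finset.range (n + 1), w (g j) = ∑ j ∈ Finset.range n, w (g' j) := by
  refine ⟨Function.update g k (g n), ?_⟩
  rw [Finset.sum_range_succ]
  by_cases hkn : k = n
  · subst hkn
    rw [h0, add_zero, Function.update_eq_self]
  · have hk' : k ∈ Finset.range n := Finset.mem_range.2 (by omega)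
    rw [← Finset.add_sum_erase _ _ hk', h0, zero_add,
      ← Finset.add_sum_erase _ (fun j => w (Function.update g k (g n) j)) hk',
      Function.update_self, add_comm]
    congr 1
    refine Finset.sum_congr rfl fun j hj => ?_
    rw [Function.update_of_ne (Finset.ne_of_mem_erase hj)]

/-- `f 0, …, f (s - 1)` are linearly independent modulo `F`. -/
def IndepMod (F : MvPolynomial (Fin 2) ℝ) (s : ℕ) (f : ℕ → MvPolynomial (Fin 2) ℝ) : Prop :=
  ∀ a : ℕ → ℝ, F ∣ ∑ j ∈ Finset.range s, a j • f j → ∀ j < s, a j = 0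

/-- The second sum stops before `k`, so the coefficient of `f k` in the difference is still `b k`.
-/
theorem IndepMod.not_dvd_sub {F : MvPolynomial (Fin 2) ℝ} {s : ℕ}
    {f : ℕ → MvPolynomial (Fin 2) ℝ} (hf : IndepMod F s f) {k : ℕ} (hk : k < s) {b : ℕ → ℝ}
    (hb : b k ≠ 0) (a : ℕ → ℝ) :
    ¬ F ∣ ∑ j ∈ Finset.range s, b j • f j - ∑ j ∈ Finset.range k, a j • f j := by
  intro hd
  have h1 : ∑ j ∈ Finset.range k, a j • f j =
      ∑ j ∈ Finset.range s, (if j < k then a j else 0) • f j := by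
    rw [← Finset.sum_subset (Finset.range_mono hk.le)]
    · exact Finset.sum_congr rfl fun j hj => by rw [if_pos (Finset.mem_range.1 hj)]
    · intro j _ hj
      rw [if_neg (fun h => hj (Finset.mem_range.2 h)), zero_smul]
  rw [h1, ← Finset.sum_sub_distrib] at hd
  simp_rw [← sub_smul] at hd
  have := hf _ hd k hk
  simp at this
  exact hb this

/-- A sparse polynomial is congruent modulo `F` to a combination, with nonzero coefficients, of at
most as many monomials that are linearly independent modulo `F`. -/
theorem exists_indepMod_monomials (F G : MvPolynomial (Fin 2) ℝ) {t : ℕ} (hG : IsSparse t G) :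
    ∃ (s : ℕ) (e : ℕ → Fin 2 →₀ ℕ) (b : ℕ → ℝ), s ≤ t ∧
      F ∣ G - ∑ j ∈ Finset.range s, b j • MvPolynomial.monomial (e j) (1 : ℝ) ∧
      (∀ j < s, b j ≠ 0) ∧ IndepMod F s fun j => MvPolynomial.monomial (e j) 1 := by
  classical
  let w : ℝ × (Fin 2 →₀ ℕ) → MvPolynomial (Fin 2) ℝ := fun q => q.1 • MvPolynomial.monomial q.2 1
  let Rep : ℕ → Prop := fun s =>
    ∃ g : ℕ → ℝ × (Fin 2 →₀ ℕ), F ∣ G - ∑ j ∈ Finset.range s, w (g j)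
  have hrep : Rep G.support.card := by
    let ε := G.support.equivFin
    let e : ℕ → Fin 2 →₀ ℕ := fun j =>
      if h : j < G.support.card then (ε.symm ⟨j, h⟩ : Fin 2 →₀ ℕ) else 0
    refine ⟨fun j => (G.coeff (e j), e j), ?_⟩
    have : ∑ j ∈ Finset.range G.support.card, w (G.coeff (e j), e j) = G := by
      rw [Finset.sum_range]
      have h1 : ∀ j : Fin G.support.card, w (G.coeff (e j), e j) =
          w (G.coeff (ε.symm j), (ε.symm j : Fin 2 →₀ ℕ)) := fun j => by simp [e]
      simp_rw [h1]
      rw [Equiv.sum_comp ε.symm (fun x : G.support => w (G.coeff x, (x : Fin 2 →₀ ℕ))),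
        Finset.sum_coe_sort G.support fun x => w (G.coeff x, x)]
      conv_rhs => rw [G.as_sum]
      refine Finset.sum_congr rfl fun x _ => ?_
      simp [w, MvPolynomial.smul_monomial]
    rw [this, sub_self]
    exact dvd_zero _
  -- A representation of minimal length has nonzero coefficients, since a zero term could be
  -- dropped.
  have hex : ∃ s, Rep s := ⟨_, hrep⟩
  obtain ⟨g, hg⟩ := Nat.find_spec hex
  set s := Nat.find hex with hs
  have hmin : ∀ g' : ℕ → ℝ × (Fin 2 →₀ ℕ), F ∣ G - ∑ j ∈ Finset.range s, w (g' j) →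
      ∀ k < s, (g' k).1 ≠ 0 := by
    intro g' hg' k hk h0
    obtain ⟨n, hn⟩ : ∃ n, s = n + 1 := ⟨s - 1, by omega⟩
    rw [hn] at hg' hk
    obtain ⟨g'', h''⟩ := Finset.exists_sum_range_eq_of_eq_zero n k hk g' w (by simp [w, h0])
    rw [h''] at hg'
    exact Nat.find_min hex (m := n) (by omega) ⟨g'', hg'⟩
  refine ⟨s, fun j => (g j).2, fun j => (g j).1, (Nat.find_min' hex hrep).trans hG, hg,
    hmin g hg, ?_⟩
  intro a ha k hk
  by_contra hak
  -- Subtracting the multiple of the relation that cancels the coefficient at `k` contradicts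
  -- minimality.
  refine hmin (fun j => ((g j).1 - (g k).1 / a k * a j, (g j).2)) ?_ k hk ?_
  · have : ∑ j ∈ Finset.range s, w ((g j).1 - (g k).1 / a k * a j, (g j).2) =
        ∑ j ∈ Finset.range s, w (g j) - ((g k).1 / a k) •
          ∑ j ∈ Finset.range s, a j • MvPolynomial.monomial (g j).2 (1 : ℝ) := by
      rw [Finset.smul_sum, ← Finset.sum_sub_distrib]
      refine Finset.sum_congr rfl fun j _ => ?_
      simp only [w, sub_smul, mul_smul]
    rw [this, ← sub_add]
    exact dvd_add hg (dvd_smul_of_dvd _ ha)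
  · simp [hak]

namespace IsGenericCurve

variable {c : ℝ} {F : MvPolynomial (Fin 2) ℝ}

/-- A vanishing Wronskian means linear dependence. On the curve, `wronskianSnoc k f g / wronskian (k
+ 1) f` has derivative zero, hence is a constant `r`; linearity turns this into a vanishing
Wronskian of `g - r • f k` of lower order. -/
theorem exists_dvd_sub_sum (h : IsGenericCurve c F) {x : Fin 2 → ℝ}
    (hx : MvPolynomial.eval x F = 0) (hgood : ¬ IsBadParam c F (x 0 - c * x 1))
    (f : ℕ → MvPolynomial (Fin 2) ℝ) (k : ℕ) (g : MvPolynomial (Fin 2) ℝ)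
    (hw : ∀ j ≤ k, ¬ F ∣ (hamiltonian F).wronskian j f)
    (hd : F ∣ (hamiltonian F).wronskianSnoc k f g) :
    ∃ a : ℕ → ℝ, F ∣ g - ∑ j ∈ Finset.range k, a j • f j := by
  induction k generalizing g with
  | zero =>
    rw [Derivation.wronskianSnoc_zero] at hd
    exact ⟨0, by simpa using hd⟩
  | succ k ih =>
    have hne : (hamiltonian F).wronskian k f ≠ 0 := fun h0 =>
      hw k (by omega) (h0 ▸ dvd_zero F)
    have hid := (hamiltonian F).wronskian_mul_wronskianSnoc_succ k f g hne
    obtain ⟨r, hr⟩ := h.exists_dvd_sub_smul hx hgood (hw (k + 1) le_rfl)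
      (hid ▸ hd.mul_left ((hamiltonian F).wronskian k f))
    rw [← Derivation.wronskianSnoc_self, ← map_smul, ← map_sub] at hr
    obtain ⟨a, ha⟩ := ih (g - r • f k) (fun j hj => hw j (by omega)) hr
    refine ⟨Function.update a k r, ?_⟩
    rw [Finset.sum_range_succ, Function.update_self, Finset.sum_congr rfl fun j hj => by
      rw [Function.update_of_ne (Finset.mem_range.1 hj).ne], ← sub_sub, sub_right_comm]
    exact ha

theorem not_dvd_wronskian (h : IsGenericCurve c F) {x : Fin 2 → ℝ}
    (hx : MvPolynomial.eval x F = 0) (hgood : ¬ IsBadParam c F (x 0 - c * x 1)) {s : ℕ}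
    {f : ℕ → MvPolynomial (Fin 2) ℝ} (hf : IndepMod F s f) (k : ℕ) (hk : k ≤ s) :
    ¬ F ∣ (hamiltonian F).wronskian k f := by
  induction k using Nat.strong_induction_on with
  | _ k ih =>
    rcases k with _ | k
    · rw [Derivation.wronskian_zero]
      exact fun hd => h.irreducible.not_isUnit (isUnit_of_dvd_one hd)
    · intro hd
      rw [← Derivation.wronskianSnoc_self] at hd
      obtain ⟨a, ha⟩ := h.exists_dvd_sub_sum hx hgood f k (f k)
        (fun j hj => ih j (by omega) (by omega)) hd
      refine hf.not_dvd_sub (k := k) (by omega) (b := Pi.single k 1) (by simp) a ?_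
      rw [Finset.sum_eq_single k]
      · simpa using ha
      · intro j _ hj; simp [hj]
      · intro hk'; exact absurd (Finset.mem_range.2 (by omega)) hk'

theorem not_dvd_wronskianSnoc (h : IsGenericCurve c F) {x : Fin 2 → ℝ}
    (hx : MvPolynomial.eval x F = 0) (hgood : ¬ IsBadParam c F (x 0 - c * x 1)) {s : ℕ}
    {f : ℕ → MvPolynomial (Fin 2) ℝ} (hf : IndepMod F s f) {k : ℕ} (hk : k < s) {b : ℕ → ℝ}
    (hb : b k ≠ 0) :
    ¬ F ∣ (hamiltonian F).wronskianSnoc k f (∑ j ∈ Finset.range s, b j • f j) := by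
  intro hd
  obtain ⟨a, ha⟩ := h.exists_dvd_sub_sum hx hgood f k _
    (fun j hj => h.not_dvd_wronskian hx hgood hf j (by omega)) hd
  exact hf.not_dvd_sub hk hb a ha

/-- The number of good zeros of a combination of `s` functions in terms of the number of good
zeros of their Wronskians. -/
theorem ncard_goodZeros_sum_le (h : IsGenericCurve c F) {x : Fin 2 → ℝ}
    (hx : MvPolynomial.eval x F = 0) (hgood : ¬ IsBadParam c F (x 0 - c * x 1)) {s : ℕ}
    (hs : 0 < s) {f : ℕ → MvPolynomial (Fin 2) ℝ} (hf : IndepMod F s f) {b : ℕ → ℝ}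
    (hb : ∀ j < s, b j ≠ 0) {Z : ℕ}
    (hZ : ∀ k ≤ s, (goodZeros c F ((hamiltonian F).wronskian k f)).ncard ≤ Z) :
    (goodZeros c F (∑ j ∈ Finset.range s, b j • f j)).ncard ≤
      (s - 1) * (3 * Z + (h.badParams.card + 1) * F.totalDegree) + Z := by
  set g := ∑ j ∈ Finset.range s, b j • f j with hg
  -- Descending induction on the order `s - 1 - m`, from `b (s - 1)` times the full Wronskian down
  -- to `g` itself.
  have key : ∀ m < s,
      (goodZeros c F ((hamiltonian F).wronskianSnoc (s - 1 - m) f g)).ncard ≤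
        m * (3 * Z + (h.badParams.card + 1) * F.totalDegree) + Z := by
    intro m
    induction m with
    | zero =>
      intro _
      obtain ⟨n, rfl⟩ : ∃ n, s = n + 1 := ⟨s - 1, by omega⟩
      have e1 : (hamiltonian F).wronskianSnoc n f g =
          b n • (hamiltonian F).wronskian (n + 1) f := by
        rw [hg, map_sum, Finset.sum_range_succ, Finset.sum_eq_zero, zero_add, map_smul,
          Derivation.wronskianSnoc_self]
        intro j hj
        rw [map_smul, Derivation.wronskianSnoc_of_lt _ (Finset.mem_range.1 hj), smul_zero]
      have e2 : goodZeros c F ((hamiltonian F).wronskianSnoc n f g) =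
          goodZeros c F ((hamiltonian F).wronskian (n + 1) f) := by
        rw [e1]
        ext y
        simp [goodZeros, MvPolynomial.smul_eval, hb n (by omega)]
      simp only [Nat.add_sub_cancel, Nat.sub_zero, zero_mul, zero_add]
      rw [e2]
      exact hZ _ le_rfl
    | succ m ih =>
      intro hm
      obtain ⟨k, hk⟩ : ∃ k, s - 1 - m = k + 1 := ⟨s - 1 - m - 1, by omega⟩
      have hk' : s - 1 - (m + 1) = k := by omega
      have hih := ih (by omega)
      rw [hk] at hih
      rw [hk']
      have hw := fun j hj => h.not_dvd_wronskian hx hgood hf j hj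
      have hne : (hamiltonian F).wronskian k f ≠ 0 := fun h0 =>
        hw k (by omega) (h0 ▸ dvd_zero F)
      -- Here `V` and `W` are the Wronskians of orders `k` and `k + 1`. They cost `Z` and `2 * Z`,
      -- whence `3 * Z` per step.
      have hstep := h.ncard_goodZeros_le
        (h.not_dvd_wronskianSnoc hx hgood hf (k := k) (by omega) (hb k (by omega)))
        (h.not_dvd_wronskianSnoc hx hgood hf (k := k + 1) (by omega) (hb (k + 1) (by omega)))
        (hw k (by omega)) (hw (k + 1) (by omega))
        ((hamiltonian F).wronskian_mul_wronskianSnoc_succ k f g hne)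
      have z1 := hZ k (by omega)
      have z2 := hZ (k + 1) (by omega)
      rw [← hg] at hstep
      rw [add_mul, one_mul]
      omega
  have := key (s - 1) (by omega)
  rwa [Nat.sub_self, Derivation.wronskianSnoc_zero] at this

theorem eval_X_ne_zero (h : IsGenericCurve c F) {x : Fin 2 → ℝ}
    (hx : MvPolynomial.eval x F = 0) (hgood : ¬ IsBadParam c F (x 0 - c * x 1)) (i : Fin 2) :
    x i ≠ 0 := by
  intro h0
  refine hgood ⟨x 1, h.snd_mem_fiberRoots hx, ?_⟩
  rw [shearPoint_coords, badPoly, map_mul, map_mul, MvPolynomial.eval_X, MvPolynomial.eval_X]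
  fin_cases i
  · simp only [Fin.zero_eta] at h0; rw [h0]; ring
  · simp only [Fin.mk_one] at h0; rw [h0]; ring

/-- Good points lie off the axes, so the monomials do not vanish there. Bézout applies to the
remaining factor, of degree at most `k(k-1)/2` times that of `F`. -/
theorem two_mul_ncard_goodZeros_wronskian_le (h : IsGenericCurve c F) (e : ℕ → Fin 2 →₀ ℕ)
    (k : ℕ) (hk : ¬ F ∣ (hamiltonian F).wronskian k fun j => MvPolynomial.monomial (e j) 1) :
    2 * (goodZeros c F ((hamiltonian F).wronskian k fun j =>
      MvPolynomial.monomial (e j) 1)).ncard ≤ F.totalDegree ^ 2 * k ^ 2 := by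
  obtain ⟨q, hq, hdeg⟩ := exists_wronskian_monomial_eq F h.totalDegree_pos e k
  rw [hq] at hk ⊢
  have hFq : ¬ F ∣ q := fun hd => hk (hd.mul_left _)
  have hsub : goodZeros c F ((∏ j : Fin k, MvPolynomial.monomial (e j) 1) * q) ⊆
      {x | MvPolynomial.eval x F = 0 ∧ MvPolynomial.eval x q = 0} := by
    rintro x ⟨hx, hgood, h0⟩
    refine ⟨hx, ?_⟩
    rw [map_mul, map_prod] at h0
    refine (mul_eq_zero.1 h0).resolve_left (Finset.prod_ne_zero_iff.2 fun j _ => ?_)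
    rw [MvPolynomial.eval_monomial, one_mul]
    exact Finset.prod_ne_zero_iff.2 fun i _ => pow_ne_zero _ (h.eval_X_ne_zero hx hgood i)
  have h1 := (Set.ncard_le_ncard hsub (commonZeros_finite h.irreducible hFq)).trans
    (ncard_commonZeros_le h.irreducible rfl hFq hdeg)
  have h2 := Finset.sum_range_id_mul_two k
  have h3 : k * (k - 1) ≤ k * k := Nat.mul_le_mul_left k (Nat.sub_le k 1)
  calc _ ≤ 2 * (F.totalDegree * ((∑ i ∈ Finset.range k, i) * F.totalDegree)) := by omega
    _ = F.totalDegree ^ 2 * ((∑ i ∈ Finset.range k, i) * 2) := by ring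
    _ ≤ F.totalDegree ^ 2 * (k * k) := Nat.mul_le_mul_left _ (h2 ▸ h3)
    _ = _ := by ring

theorem badFiber_subset (h : IsGenericCurve c F) :
    {x | MvPolynomial.eval x F = 0 ∧ IsBadParam c F (x 0 - c * x 1)} ⊆
      (fun q : Σ _ : ℝ, ℝ => shearPoint c q.1 q.2) ''
        (h.badParams.sigma fun u => fiberRoots c F u : Finset (Σ _ : ℝ, ℝ)) := by
  rintro x ⟨hx, hb⟩
  exact ⟨⟨x 0 - c * x 1, x 1⟩, Finset.mem_coe.2 (Finset.mem_sigma.2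
    ⟨(h.mem_badParams _).2 hb, h.snd_mem_fiberRoots hx⟩), shearPoint_coords c x⟩

theorem finite_badFiber (h : IsGenericCurve c F) :
    {x | MvPolynomial.eval x F = 0 ∧ IsBadParam c F (x 0 - c * x 1)}.Finite :=
  ((Finset.finite_toSet _).image _).subset h.badFiber_subset

theorem ncard_badFiber_le (h : IsGenericCurve c F) :
    {x | MvPolynomial.eval x F = 0 ∧ IsBadParam c F (x 0 - c * x 1)}.ncard ≤
      h.badParams.card * F.totalDegree := by
  refine (Set.ncard_le_ncard h.badFiber_subset ((Finset.finite_toSet _).image _)).trans ?_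
  refine (Set.ncard_image_le (Finset.finite_toSet _)).trans ?_
  rw [Set.ncard_coe_finset, Finset.card_sigma]
  simpa using Finset.sum_le_card_nsmul h.badParams _ _ fun u _ => h.card_fiberRoots_le u

theorem two_mul_ncard_realSolutions_le (h : IsGenericCurve c F) {G : MvPolynomial (Fin 2) ℝ}
    {t : ℕ} (ht : 1 ≤ t) (hG : IsSparse t G) (hfin : (realSolutions F G).Finite) :
    2 * (realSolutions F G).ncard ≤
      2 * F.totalDegree ^ 3 * t + 7 * F.totalDegree ^ 2 * t ^ 3 := by
  set d := F.totalDegree with hd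
  have hd1 : 1 ≤ d := h.totalDegree_pos
  have hB : h.badParams.card ≤ d * (d + 1) := h.card_badParams_le
  have hsplit : realSolutions F G ⊆
      {x | MvPolynomial.eval x F = 0 ∧ IsBadParam c F (x 0 - c * x 1)} ∪ goodZeros c F G := by
    rintro x ⟨hx, hxG⟩
    by_cases hb : IsBadParam c F (x 0 - c * x 1)
    · exact Or.inl ⟨hx, hb⟩
    · exact Or.inr ⟨hx, hb, hxG⟩
  have hgf : (goodZeros c F G).Finite := hfin.subset fun x hx => ⟨hx.1, hx.2.2⟩
  have h1 := (Set.ncard_le_ncard hsplit (h.finite_badFiber.union hgf)).trans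
    (Set.ncard_union_le _ _)
  have h2 := h.ncard_badFiber_le
  rw [← hd] at h2
  have h3 : 2 * (goodZeros c F G).ncard ≤
      2 * (t - 1) * ((h.badParams.card + 1) * d) + 3 * d ^ 2 * t ^ 3 := by
    rcases (goodZeros c F G).eq_empty_or_nonempty with h0 | ⟨x, hx, hgood, hxG⟩
    · simp [h0]
    · obtain ⟨s, e, b, hst, hdvd, hb, hind⟩ := exists_indepMod_monomials F G hG
      have hcongr : ∀ y, MvPolynomial.eval y F = 0 → MvPolynomial.eval y G =
          MvPolynomial.eval y
            (∑ j ∈ Finset.range s, b j • MvPolynomial.monomial (e j) (1 : ℝ)) := by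
        intro y hy
        obtain ⟨q, hq⟩ := hdvd
        have := congrArg (MvPolynomial.eval y) hq
        rw [map_sub, map_mul, hy, zero_mul, sub_eq_zero] at this
        exact this
      -- If `s = 0`, then `G` vanishes on the whole curve, which is infinite as it has a good point.
      have hs : 0 < s := by
        rcases Nat.eq_zero_or_pos s with h0 | h0
        · subst h0
          refine absurd (hfin.subset fun y hy => ⟨hy, ?_⟩) (h.infinite_zeros hx hgood)
          rw [hcongr y hy]; simp
        · exact h0
      have hset : goodZeros c F G = goodZeros c F
          (∑ j ∈ Finset.range s, b j • MvPolynomial.monomial (e j) (1 : ℝ)) := by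
        ext y
        constructor
        · rintro ⟨p1, p2, p3⟩; exact ⟨p1, p2, by rw [← hcongr y p1, p3]⟩
        · rintro ⟨p1, p2, p3⟩; exact ⟨p1, p2, by rw [hcongr y p1, p3]⟩
      have hZ : ∀ k ≤ s, (goodZeros c F ((hamiltonian F).wronskian k fun j =>
          MvPolynomial.monomial (e j) 1)).ncard ≤ d ^ 2 * t ^ 2 / 2 := by
        intro k hk
        have z1 := h.two_mul_ncard_goodZeros_wronskian_le e k
          (h.not_dvd_wronskian hx hgood hind k hk)
        rw [← hd] at z1
        have z2 : d ^ 2 * k ^ 2 ≤ d ^ 2 * t ^ 2 :=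
          Nat.mul_le_mul_left _ (Nat.pow_le_pow_left (hk.trans hst) 2)
        omega
      have hmain := h.ncard_goodZeros_sum_le hx hgood hs hind hb hZ
      rw [← hset] at hmain
      set Z := d ^ 2 * t ^ 2 / 2 with hZdef
      have hZ2 : 2 * Z ≤ d ^ 2 * t ^ 2 := by omega
      obtain ⟨n, rfl⟩ : ∃ n, t = n + 1 := ⟨t - 1, by omega⟩
      have hsn : s - 1 ≤ n := by omega
      have hm2 := hmain.trans (Nat.add_le_add_right (Nat.mul_le_mul_right _ hsn) Z)
      rw [Nat.add_sub_cancel]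
      calc 2 * (goodZeros c F G).ncard
          ≤ 2 * (n * (3 * Z + (h.badParams.card + 1) * d) + Z) := Nat.mul_le_mul_left 2 hm2
        _ = 2 * n * ((h.badParams.card + 1) * d) + (3 * n + 1) * (2 * Z) := by ring
        _ ≤ 2 * n * ((h.badParams.card + 1) * d) +
            (3 * (n + 1)) * (d ^ 2 * (n + 1) ^ 2) := by gcongr; omega
        _ = _ := by ring
  obtain ⟨n, rfl⟩ : ∃ n, t = n + 1 := ⟨t - 1, by omega⟩
  rw [Nat.add_sub_cancel] at h3
  have h4 : h.badParams.card * d ≤ d * (d + 1) * d := Nat.mul_le_mul_right _ hB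
  have h5 : 2 * n * ((h.badParams.card + 1) * d) ≤ 2 * n * ((d * (d + 1) + 1) * d) := by gcongr
  have h6 : 2 * (realSolutions F G).ncard ≤ 2 * (d * (d + 1) * d) +
      2 * n * ((d * (d + 1) + 1) * d) + 3 * d ^ 2 * (n + 1) ^ 3 := by omega
  have h7 : d ≤ d ^ 2 := Nat.le_self_pow two_ne_zero d
  have h8 : n + 1 ≤ (n + 1) ^ 3 := Nat.le_self_pow three_ne_zero _
  -- The terms in `d ^ 2 * t` and `d * t`, each with coefficient 2, are absorbed into `d ^ 2 * t ^
  -- 3`, whose coefficient rises from 3 to 7.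
  calc _ ≤ _ := h6
    _ ≤ 2 * d ^ 3 * (n + 1) + 2 * d ^ 2 * (n + 1) + 2 * d * (n + 1) +
        3 * d ^ 2 * (n + 1) ^ 3 := by nlinarith
    _ ≤ 2 * d ^ 3 * (n + 1) + 2 * d ^ 2 * (n + 1) ^ 3 + 2 * d ^ 2 * (n + 1) ^ 3 +
        3 * d ^ 2 * (n + 1) ^ 3 := by gcongr
    _ = _ := by ring

end IsGenericCurve

end Counting

/-! ### Descent to the reals, coordinate axes and the final bounds -/

theorem MvPolynomial.irreducible_of_irreducible_map_complex {F : MvPolynomial (Fin 2) ℝ}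
    (h : Irreducible (MvPolynomial.map (algebraMap ℝ ℂ) F)) : Irreducible F := by
  -- A real factorization is also a complex one, so it is enough that units descend: they are the
  -- nonzero constants.
  have hunit : ∀ p : MvPolynomial (Fin 2) ℝ,
      IsUnit (MvPolynomial.map (algebraMap ℝ ℂ) p) → IsUnit p := by
    intro p hp
    rw [MvPolynomial.isUnit_iff_eq_C_of_isReduced] at hp ⊢
    obtain ⟨r, hr, he⟩ := hp
    have h1 : p = C (p.coeff 0) := by
      ext m
      have := congrArg (MvPolynomial.coeff m) he
      rw [MvPolynomial.coeff_map, MvPolynomial.coeff_C] at this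
      rw [MvPolynomial.coeff_C]
      split_ifs with hm
      · rw [hm]
      · rw [if_neg hm] at this
        exact (map_eq_zero _).1 this
    refine ⟨_, isUnit_iff_ne_zero.2 fun h0 => ?_, h1⟩
    rw [h0, map_zero] at h1
    rw [h1, map_zero] at he
    exact hr.ne_zero (MvPolynomial.C_eq_zero.1 he.symm)
  refine ⟨fun hu => h.not_isUnit (hu.map _), fun a b hab => ?_⟩
  exact (h.isUnit_or_isUnit (by rw [hab, map_mul])).imp (hunit a) (hunit b)

theorem two_mul_ncard_realSolutions_le_of_not_dvd_X {F G : MvPolynomial (Fin 2) ℝ}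
    (hF : Irreducible F) (hX : ∀ i, ¬ F ∣ MvPolynomial.X i) {t : ℕ} (ht : 1 ≤ t)
    (hG : IsSparse t G) (hfin : (realSolutions F G).Finite) :
    2 * (realSolutions F G).ncard ≤
      2 * F.totalDegree ^ 3 * t + 7 * F.totalDegree ^ 2 * t ^ 3 := by
  obtain ⟨c, hc⟩ := exists_coeff_fiberPoly_ne_zero F hF.ne_zero
  exact IsGenericCurve.two_mul_ncard_realSolutions_le (c := c) ⟨hF, hX, hc⟩ ht hG hfin

/-- If `F` defines a coordinate axis, the system can be moved to a parallel line. -/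
theorem exists_system_of_dvd_X {F G : MvPolynomial (Fin 2) ℝ} (hF : Irreducible F) {i : Fin 2}
    (hX : F ∣ MvPolynomial.X i) {t : ℕ} (hG : IsSparse t G)
    (hfin : (realSolutions F G).Finite) : ∃ F' G' : MvPolynomial (Fin 2) ℝ, Irreducible F' ∧
      F'.totalDegree = F.totalDegree ∧ (∀ j, ¬ F' ∣ MvPolynomial.X j) ∧ IsSparse t G' ∧
      (realSolutions F' G').Finite ∧
      (realSolutions F G).ncard ≤ (realSolutions F' G').ncard := by
  classical
  have hassoc : Associated F (MvPolynomial.X i) :=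
    hF.associated_of_dvd MvPolynomial.X_prime.irreducible hX
  have hF0 : ∀ x : Fin 2 → ℝ, MvPolynomial.eval x F = 0 ↔ x i = 0 := by
    intro x
    have := hassoc.map (MvPolynomial.eval x)
    rw [MvPolynomial.eval_X] at this
    exact this.eq_zero_iff
  have hdegF : F.totalDegree = 1 := by
    have h1 := MvPolynomial.totalDegree_le_of_dvd_of_isDomain hX (MvPolynomial.X_ne_zero i)
    have h2 := MvPolynomial.totalDegree_le_of_dvd_of_isDomain hassoc.symm.dvd hF.ne_zero
    rw [MvPolynomial.totalDegree_X] at h1 h2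
    omega
  have hdeg' : (MvPolynomial.X i - MvPolynomial.C 1 : MvPolynomial (Fin 2) ℝ).totalDegree = 1 := by
    refine le_antisymm ((MvPolynomial.totalDegree_sub_C_le _ _).trans
      (MvPolynomial.totalDegree_X i).le) ?_
    have := MvPolynomial.totalDegree_add
      (MvPolynomial.X i - MvPolynomial.C 1 : MvPolynomial (Fin 2) ℝ) (MvPolynomial.C 1)
    rw [sub_add_cancel, MvPolynomial.totalDegree_X, MvPolynomial.totalDegree_C] at this
    simpa using this
  -- Only the monomials free of `X i` survive on the axis, and they take the same values on the line
  -- `X i = 1`.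
  let G' : MvPolynomial (Fin 2) ℝ :=
    ∑ e ∈ G.support.filter (fun e => e i = 0), MvPolynomial.monomial e (G.coeff e)
  have hG' : ∀ x y : Fin 2 → ℝ, x i = 0 → (∀ j ≠ i, x j = y j) →
      MvPolynomial.eval y G' = MvPolynomial.eval x G := by
    intro x y hx hxy
    simp only [G', map_sum]
    conv_rhs => rw [G.as_sum, map_sum]
    rw [Finset.sum_filter]
    refine Finset.sum_congr rfl fun e _ => ?_
    rw [MvPolynomial.eval_monomial, MvPolynomial.eval_monomial,
      Finsupp.prod_fintype _ _ (fun _ => pow_zero _), Finsupp.prod_fintype _ _ (fun _ => pow_zero _)]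
    split_ifs with he
    · congr 1
      refine Finset.prod_congr rfl fun j _ => ?_
      by_cases hj : j = i
      · rw [hj, he, pow_zero, pow_zero]
      · rw [hxy j hj]
    · rw [Finset.prod_eq_zero (Finset.mem_univ i) (by rw [hx, zero_pow he]), mul_zero]
  have hsol : ∀ y, y ∈ realSolutions (MvPolynomial.X i - MvPolynomial.C 1) G' ↔
      y i = 1 ∧ MvPolynomial.eval y G' = 0 := by
    intro y
    simp [realSolutions, sub_eq_zero]
  have h1 : realSolutions (MvPolynomial.X i - MvPolynomial.C 1) G' ⊆
      (fun x => Function.update x i 1) '' realSolutions F G := by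
    intro y hy
    rw [hsol] at hy
    refine ⟨Function.update y i 0, ⟨(hF0 _).2 (by simp), ?_⟩, ?_⟩
    · rw [← hG' _ y (by simp) (fun j hj => by simp [hj]), hy.2]
    · rw [← hy.1]; simp
  have h2 : realSolutions F G ⊆ (fun y => Function.update y i 0) ''
      realSolutions (MvPolynomial.X i - MvPolynomial.C 1) G' := by
    rintro x ⟨hx, hxG⟩
    rw [hF0] at hx
    refine ⟨Function.update x i 1, (hsol _).2 ⟨by simp, ?_⟩, ?_⟩
    · rw [hG' x _ hx (fun j hj => by simp [hj]), hxG]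
    · rw [← hx]; simp
  have hfin' := (hfin.image (fun x => Function.update x i 1)).subset h1
  refine ⟨MvPolynomial.X i - MvPolynomial.C 1, G', ?_, ?_, ?_, ?_, hfin', ?_⟩
  · refine MvPolynomial.irreducible_of_totalDegree_eq_one hdeg' fun r hr => ?_
    have := hr (Finsupp.single i 1)
    rw [MvPolynomial.coeff_sub, MvPolynomial.coeff_X, MvPolynomial.coeff_C] at this
    refine isUnit_of_dvd_one ?_
    simpa [Finsupp.single_eq_zero, eq_comm] using this
  · rw [hdeg', hdegF]
  -- At the point `(1, 1)`, `X i - 1` vanishes and `X j` does not.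
  · rintro j ⟨q, hq⟩
    have := congrArg (MvPolynomial.eval fun _ => (1 : ℝ)) hq
    simp at this
  · refine (Finset.card_le_card ?_).trans hG
    refine (MvPolynomial.support_sum).trans (Finset.biUnion_subset.2 fun e he => ?_)
    refine MvPolynomial.support_monomial_subset.trans ?_
    exact Finset.singleton_subset_iff.2 (Finset.mem_filter.1 he).1
  · exact (Set.ncard_le_ncard h2 (hfin'.image _)).trans (Set.ncard_image_le hfin')

/-- The explicit bound `d³t + (7/2)d²t³`. It lies below `2d³t + 4d²t³` for all `d` and `t`, so no
error term is needed in the main theorem. The bound comes from Rolle's theorem along the branches of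
the curve, applied to Wronskians of monomials with respect to the Hamiltonian derivation of `F`. -/
theorem IsAdmissibleSystem.ncard_realSolutions_le {d t : ℕ} {F G : MvPolynomial (Fin 2) ℝ}
    (ht : 1 ≤ t) (h : IsAdmissibleSystem d t F G) :
    ((realSolutions F G).ncard : ℝ) ≤ (d : ℝ) ^ 3 * t + 7 / 2 * ((d : ℝ) ^ 2 * (t : ℝ) ^ 3) := by
  have hF := MvPolynomial.irreducible_of_irreducible_map_complex h.irreducible
  have key : 2 * (realSolutions F G).ncard ≤ 2 * d ^ 3 * t + 7 * d ^ 2 * t ^ 3 := by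
    rw [← h.totalDegree_eq]
    by_cases hX : ∀ i, ¬ F ∣ MvPolynomial.X i
    · exact two_mul_ncard_realSolutions_le_of_not_dvd_X hF hX ht h.sparse h.finite
    · push Not at hX
      obtain ⟨i, hi⟩ := hX
      obtain ⟨F', G', h1, h2, h3, h4, h5, h6⟩ := exists_system_of_dvd_X hF hi h.sparse h.finite
      have := two_mul_ncard_realSolutions_le_of_not_dvd_X h1 h3 ht h4 h5
      rw [h2] at this
      omega
  have key' : (2 * (realSolutions F G).ncard : ℝ) ≤
      2 * (d : ℝ) ^ 3 * t + 7 * (d : ℝ) ^ 2 * (t : ℝ) ^ 3 := by exact_mod_cast key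
  linarith

theorem mainTheorem2 :
    (∃ C : ℝ, ∀ (d t : ℕ) (F G : MvPolynomial (Fin 2) ℝ), 1 ≤ t → IsAdmissibleSystem d t F G →
      ((realSolutions F G).ncard : ℝ) ≤ C * ((d : ℝ) ^ 3 * t + (d : ℝ) ^ 2 * (t : ℝ) ^ 3)) ∧
    (∃ ε : ℕ × ℕ → ℝ, Asymptotics.IsLittleO Filter.cofinite ε (fun _ : ℕ × ℕ => (1 : ℝ)) ∧
      ∀ (d t : ℕ) (F G : MvPolynomial (Fin 2) ℝ), 1 ≤ t → IsAdmissibleSystem d t F G →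
        ((realSolutions F G).ncard : ℝ) ≤
          (2 * (d : ℝ) ^ 3 * t + 4 * (d : ℝ) ^ 2 * (t : ℝ) ^ 3) * (1 + ε (d, t))) := by
  -- Both coefficients 1 and 7/2 are at most 4, and they are at most 2 and 4 respectively, so the
  -- error term can be zero.
  refine ⟨⟨4, fun d t F G ht h => ?_⟩, ⟨fun _ => 0, Asymptotics.isLittleO_zero _ _,
    fun d t F G ht h => ?_⟩⟩
  all_goals
    have hle := h.ncard_realSolutions_le ht
    have h1 : (0 : ℝ) ≤ (d : ℝ) ^ 3 * t := by positivity
    have h2 : (0 : ℝ) ≤ (d : ℝ) ^ 2 * (t : ℝ) ^ 3 := by positivity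
    linarith
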